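/- Let $M$ be a smooth surface (a two-dimensional Hausdorff, second countable manifold, possibly with boundary or corners, not necessarily compact), let $J\subseteq\mathbb R$ be a nondegenerate interval of times (for instance $J=[0,T)$), and let $\Phi_t:M\to\mathbb R^3$, $t\in J$, be a family of smooth immersions that is jointly smooth in $(t,p)\in J\times M$, with smooth initial immersion $\Phi_0$. Let $g_t$ be the metric that $\Phi_t$ induces on $M$, $dA_t$ its area measure, $\nabla_0$ and $\Delta_0$ the gradient and the Laplace–Beltrami operator of $g_0$, and $\sqrt{|g_t|/|g_0|}=\sqrt{\det(g_0^{-1}g_t)}$ the ratio of the area elements. Operators and integrals are applied to $\mathbb R^3$-valued maps componentwise. A test function is a smooth, compactly supported $B:M\to\mathbb R$ that vanishes on $\partial M$ (any smooth function, if $M$ is closed). Fix $t\in J$. (1) For every test function $B$ all of the following integrands are integrable, and $$\int_M \frac{\partial\Phi_t}{\partial t}\,B\,dA_t=\int_M\sqrt{\frac{|g_t|}{|g_0|}}\,\frac{\partial\Phi_t}{\partial t}\,B\,dA_0,$$ $$\int_M \sqrt{\frac{|g_0|}{|g_t|}}\,\Delta_0\Phi_t\,B\,dA_t=\int_M\Delta_0\Phi_t\,B\,dA_0=-\int_M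 g_0(\nabla_0\Phi_t,\nabla_0B)\,dA_0 .$$ (2) The modified flow, with the mass form of time $t$ and the stiffness form of time $0$, is the weak form of the PDE. That is, the following are equivalent: - (a) $\frac{\partial\Phi_t}{\partial t}=\sqrt{\frac{|g_0|}{|g_t|}}\,\Delta_0\Phi_t$ at every point of $M$; - (b) the same equation holds at every interior point of $M$; - (c) $\int_M\frac{\partial\Phi_t}{\partial t}B\,dA_t=\int_M\sqrt{\frac{|g_0|}{|g_t|}}\,\Delta_0\Phi_t\,B\,dA_t$ for every test function $B$ (the Galerkin formulation of the PDE); - (d) $\int_M\frac{\partial\Phi_t}{\partial t}B\,dA_t=-\int_M g_0(\nabla_0\Phi_t,\nabla_0B)\,dA_0$ for every test function $B$ (the modified flow). (3) Let $B_1,\dots,B_N:M\to\mathbb R$ be smooth, and suppose that $\Phi_s=\sum_j x_j(s)B_j$ for all $s\in J$, with $x_j(s)\in\mathbb R^3$. Put $D^t_{ij}=\int_M B_iB_j\,dA_t$ and $L^0_{ij}=-\int_M g_0(\nabla_0B_i,\nabla_0B_j)\,dA_0$. Then for every $i$ such that $B_i$ is a test function (every $i$, if $M$ is closed): - if the $x_j$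 are differentiable at $t$, then the Galerkin equation (c) with $B=B_i$ is equivalent to $\sum_jD^t_{ij}\,x_j'(t)=\sum_jL^0_{ij}\,x_j(t)$; - for every $\delta>0$ and $y_1,\dots,y_N\in\mathbb R^3$, with $\Psi=\sum_jy_jB_j$, the semi-implicit Galerkin equation $\int_M\frac{\Psi-\Phi_t}{\delta}B_i\,dA_t=\int_M\sqrt{\frac{|g_0|}{|g_t|}}\,\Delta_0\Psi\,B_i\,dA_t$ is equivalent to $\sum_j(D^t_{ij}-\delta L^0_{ij})\,y_j=\sum_jD^t_{ij}\,x_j(t)$. -/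

import Mathlib

open MeasureTheory
open scoped Manifold ContDiff Matrix

noncomputable section

namespace ModifiedMCF

/-- The model space `ℝ²` of a surface. -/
abbrev Plane := EuclideanSpace ℝ (Fin 2)

/-- The ambient space `ℝ³`. -/
abbrev Space := EuclideanSpace ℝ (Fin 3)

/-- The `i`-th standard basis vector of `ℝ²`. -/
def coordVec (i : Fin 2) : Plane := EuclideanSpace.single i 1

section Geometry

variable {H : Type*} [TopologicalSpace H] (I : ModelWithCorners ℝ Plane H)
  {M : Type*} [TopologicalSpace M] [ChartedSpace H M]

/-- A smooth immersion of the surface `M` (possibly with boundary) in `ℝ³`. -/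
structure IsSmoothImmersion (f : M → Space) : Prop where
  smooth : ContMDiff I 𝓘(ℝ, Space) ∞ f
  injective_mfderiv : ∀ p : M, Function.Injective (mfderiv I 𝓘(ℝ, Space) f p)

/-! ### The induced metric at a point -/

/-- The metric `g_f(v, w) = ⟨df v, df w⟩` induced on `M` by `f : M → ℝ³`. -/
def inducedMetric (f : M → Space) (p : M) (v w : TangentSpace I p) : ℝ :=
  @inner ℝ Space _ (mfderiv I 𝓘(ℝ, Space) f p v) (mfderiv I 𝓘(ℝ, Space) f p w)

/-- The matrix of `g_f` at `p` in the standard basis of `TangentSpace I p = ℝ²`, which is the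
coordinate basis of the preferred chart at `p`. -/
def gramMatrix (f : M → Space) (p : M) : Matrix (Fin 2) (Fin 2) ℝ :=
  Matrix.of fun i j => inducedMetric I f p (coordVec i) (coordVec j)

/-- `√(|g_f₁| / |g_f₂|)` at `p`. The ratio of determinants does not depend on the basis. -/
def areaRatio (f₁ f₂ : M → Space) (p : M) : ℝ :=
  √((gramMatrix I f₁ p).det / (gramMatrix I f₂ p).det)

/-- The gradient of `u : M → ℝ` with respect to `g_f`: the tangent vector with components
`∑ j, g^{ij} ∂ⱼu`. -/
def metricGradient (f : M → Space) (u : M → ℝ) (p : M) : TangentSpace I p :=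
  WithLp.toLp 2 ((gramMatrix I f p)⁻¹ *ᵥ fun j => (mfderiv I 𝓘(ℝ, ℝ) u p (coordVec j) : ℝ))

/-- `g_f(∇_f u, ∇_f v)` at `p`. -/
def gradInner (f : M → Space) (u v : M → ℝ) (p : M) : ℝ :=
  inducedMetric I f p (metricGradient I f u p) (metricGradient I f v p)

/-! ### Area measure and Laplace–Beltrami operator -/

/-- The `i`-th partial derivative of a function `F` on the range of the model. (At points of the
frontier the derivative is taken within the range.) -/
def partialDeriv {V : Type*} [NormedAddCommGroup V] [NormedSpace ℝ V] (F : Plane → V) (i : Fin 2)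
    (x : Plane) : V :=
  fderivWithin ℝ F (Set.range I) x (coordVec i)

/-- The matrix `g_{ij} = ⟨∂ᵢf, ∂ⱼf⟩` of `g_f` in the preferred chart at `c`, as a function of the
coordinate `x` in that chart. -/
def coordGram (f : M → Space) (c : M) (x : Plane) : Matrix (Fin 2) (Fin 2) ℝ :=
  Matrix.of fun i j =>
    @inner ℝ Space _ (partialDeriv I (f ∘ (extChartAt I c).symm) i x)
      (partialDeriv I (f ∘ (extChartAt I c).symm) j x)

/-- The measure `√|g| dx¹ dx²` on the domain of the preferred chart at `c`, extended by zero. -/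
def chartArea [MeasurableSpace M] (f : M → Space) (c : M) : Measure M :=
  ((volume.restrict (extChartAt I c).target).withDensity
    fun x => ENNReal.ofReal √(coordGram I f c x).det).map (extChartAt I c).symm

/-- The area measure `dA_f` of `g_f`: the least measure on `M` that dominates the measures
`√|g| dx¹ dx²` of all the charts. As these agree on overlaps, it restricts to each of them on the
domain of the corresponding chart. -/
def areaMeasure [MeasurableSpace M] (f : M → Space) : Measure M :=
  ⨆ c : M, chartArea I f c

/-- The expression `|g|^{-1/2} ∑ i, ∂ᵢ (|g|^{1/2} ∑ j, g^{ij} ∂ⱼu)` in the preferred chart at `c`,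
at the coordinate `x`. -/
def coordLaplacian (f : M → Space) (u : M → ℝ) (c : M) (x : Plane) : ℝ :=
  (√(coordGram I f c x).det)⁻¹ *
    ∑ i, partialDeriv I
      (fun y => √(coordGram I f c y).det *
        ∑ j, (coordGram I f c y)⁻¹ i j * partialDeriv I (u ∘ (extChartAt I c).symm) j y) i x

/-- The Laplace–Beltrami operator of `g_f`. -/
def laplaceBeltrami (f : M → Space) (u : M → ℝ) (p : M) : ℝ :=
  coordLaplacian I f u p (extChartAt I p p)

/-- The Laplace–Beltrami operator of `g_f` applied to each component of an `ℝ³`-valued map. -/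
def vectorLaplacian (f Ψ : M → Space) (p : M) : Space :=
  WithLp.toLp 2 fun a => laplaceBeltrami I f (fun q => Ψ q a) p

/-! ### Mass and stiffness -/

/-- Test functions: smooth, compactly supported, zero on the boundary of `M`. On a closed surface
these are all the smooth functions. -/
structure IsTestFunction (B : M → ℝ) : Prop where
  smooth : ContMDiff I 𝓘(ℝ, ℝ) ∞ B
  hasCompactSupport : HasCompactSupport B
  eq_zero_of_mem_boundary : ∀ p ∈ I.boundary M, B p = 0

/-- The mass form `∫ u v dA_f`. -/
def massForm [MeasurableSpace M] (f : M → Space) (u v : M → ℝ) : ℝ :=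
  ∫ p, u p * v p ∂(areaMeasure I f)

/-- The stiffness form `-∫ g_f(∇_f u, ∇_f v) dA_f`. -/
def stiffnessForm [MeasurableSpace M] (f : M → Space) (u v : M → ℝ) : ℝ :=
  -∫ p, gradInner I f u v p ∂(areaMeasure I f)

/-- The mass matrix `D_{ij} = ∫ Bᵢ Bⱼ dA_f`. -/
def massMatrix [MeasurableSpace M] {N : ℕ} (f : M → Space) (B : Fin N → M → ℝ) :
    Matrix (Fin N) (Fin N) ℝ :=
  Matrix.of fun i j => massForm I f (B i) (B j)

/-- The stiffness matrix `L_{ij} = -∫ g_f(∇_f Bᵢ, ∇_f Bⱼ) dA_f`. -/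
def stiffnessMatrix [MeasurableSpace M] {N : ℕ} (f : M → Space) (B : Fin N → M → ℝ) :
    Matrix (Fin N) (Fin N) ℝ :=
  Matrix.of fun i j => stiffnessForm I f (B i) (B j)

/-! ### Flows -/

/-- `J` is the time interval and `Φ t`, `t ∈ J`, is a smooth family of immersions of `M` in `ℝ³`,
with initial immersion `Φ 0`. Smoothness is joint in time and space. Typically `J = [0, T)`;
the time `0` need not belong to `J`. -/
structure IsImmersionFamily (J : Set ℝ) (Φ : ℝ → M → Space) : Prop where
  ordConnected : J.OrdConnected
  nontrivial : J.Nontrivial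
  initial : IsSmoothImmersion I (Φ 0)
  smooth : ContMDiffOn (𝓘(ℝ, ℝ).prod I) 𝓘(ℝ, Space) ∞ (Function.uncurry Φ) (J ×ˢ Set.univ)
  immersion : ∀ t ∈ J, IsSmoothImmersion I (Φ t)

/-- The velocity `∂Φ_t/∂t` (one-sided at an endpoint of `J`). -/
def velocity (J : Set ℝ) (Φ : ℝ → M → Space) (t : ℝ) (p : M) : Space :=
  derivWithin (fun s => Φ s p) J t

/-- The PDE `∂Φ_t/∂t = √(|g_0|/|g_t|) Δ_0 Φ_t` holds at time `t` and at the point `p`. -/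
def PDEAt (J : Set ℝ) (Φ : ℝ → M → Space) (t : ℝ) (p : M) : Prop :=
  velocity J Φ t p = areaRatio I (Φ 0) (Φ t) p • vectorLaplacian I (Φ 0) (Φ t) p

/-- The Galerkin equation of the PDE at time `t` with test function `B`: each component of the PDE
is multiplied by `B` and integrated with respect to the area measure at time `t`. -/
def GalerkinPDEAt [MeasurableSpace M] (J : Set ℝ) (Φ : ℝ → M → Space) (t : ℝ) (B : M → ℝ) : Prop :=
  ∀ a : Fin 3, ∫ p, velocity J Φ t p a * B p ∂(areaMeasure I (Φ t)) =
    ∫ p, (areaRatio I (Φ 0) (Φ t) p * vectorLaplacian I (Φ 0) (Φ t) p a) * B p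
      ∂(areaMeasure I (Φ t))

/-- The equation of the modified flow at time `t` with test function `B`: the mass form is that
of time `t` and the stiffness form is that of time `0`. -/
def ModifiedFlowAt [MeasurableSpace M] (J : Set ℝ) (Φ : ℝ → M → Space) (t : ℝ) (B : M → ℝ) : Prop :=
  ∀ a : Fin 3, massForm I (Φ t) (fun p => velocity J Φ t p a) B =
    stiffnessForm I (Φ 0) (fun p => Φ t p a) B

end Geometry

/-- The map `∑ i, xᵢ Bᵢ : M → ℝ³` with coefficients `xᵢ ∈ ℝ³`. -/
def linComb {M : Type*} {N : ℕ} (x : Fin N → Space) (B : Fin N → M → ℝ) (p : M) : Space :=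
  ∑ i, B i p • x i

end ModifiedMCF

end

open ModifiedMCF

/-!
The change of variables and the divergence theorem are proved for an arbitrary immersion `f` and an
arbitrary smooth function `u`; the equivalences follow from them.

*Area measure.* The Gram matrices of `f` in two charts are related by the Jacobian matrix `P` of
the coordinate change, `G_c = Pᵀ G_d P` (`coordGram_eq_mul`). So the area elements of the charts
agree on overlaps (`chartArea_eq_chartArea`), and the supremum `areaMeasure` of the (uncountably
many) measures `chartArea` restricts to each of them (`restrict_areaMeasure`): countably many
charts cover `M`, and the measure glued from these along a measurable partition dominates every
other one. It follows that `dA_f₁` has density `areaRatio f₁ f₂` with respect to `dA_f₂`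
(`areaMeasure_eq_withDensity`). The measure is finite on compact sets and positive on nonempty open
sets, so that a continuous function orthogonal to all the test functions vanishes
(`eq_zero_of_integral_mul_eq_zero`), at boundary points too because interior points are dense.

*Divergence theorem.* The range of a model with corners is only known to be a closed convex set
with nonempty interior. A `C¹` function on it with compact support that vanishes on the frontier
becomes a Lipschitz function when it is extended by zero, and the frontier of a convex set is
negligible. So the integral of each of its partial derivatives vanishes, by integration by parts
for Lipschitz functions (`integral_fderivWithin_apply_eq_zero`). In a chart this gives Green's
formula for the coordinate expression of the Laplacian (`integral_coordLaplacian_mul`).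

*Laplace–Beltrami operator.* `laplaceBeltrami f u p` is computed in the preferred chart at `p`,
which varies with `p`. That another chart gives the same value needs no computation of second
derivatives: by Green's formula, the coordinate expressions in two charts have the same integrals
against the test functions supported in the overlap (`coordLaplacian_eq_coordLaplacian`). The
operator therefore yields continuous functions, and a partition of unity gives Green's formula for
all test functions (`integral_laplaceBeltrami_mul`).

*Weak forms.* By the density formula and Green's formula, the Galerkin equation of the PDE is the
equation of the modified flow. Both sides of the PDE are continuous on `M` (`continuous_velocity`
for the left side), so the equation holds everywhere as soon as it holds at the interior points or
weakly (`tfae_pdeAt`). The finite element systems are the same equations, expanded by linearity.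
-/

noncomputable section

namespace ModifiedMCF

open Set Filter Topology

/-! ### Gram matrices and linear changes of coordinates -/

/-- The matrix of a linear endomorphism of `ℝ²` in the standard basis. -/
def jacobianMatrix (T : Plane →L[ℝ] Plane) : Matrix (Fin 2) (Fin 2) ℝ :=
  Matrix.of fun k i => T (coordVec i) k

theorem eq_sum_coordVec (v : Plane) : v = ∑ k, v k • coordVec k := by
  ext i
  fin_cases i <;> simp [coordVec, Fin.sum_univ_two]

theorem det_jacobianMatrix (T : Plane →L[ℝ] Plane) : (jacobianMatrix T).det = T.det := by
  have h : jacobianMatrix T = LinearMap.toMatrix (EuclideanSpace.basisFun (Fin 2) ℝ).toBasis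
      (EuclideanSpace.basisFun (Fin 2) ℝ).toBasis (T : Plane →ₗ[ℝ] Plane) := by
    ext k i
    simp [jacobianMatrix, LinearMap.toMatrix_apply, coordVec]
  rw [h, LinearMap.det_toMatrix]

theorem apply_map_coordVec {V : Type*} [NormedAddCommGroup V] [NormedSpace ℝ V]
    (D : Plane →L[ℝ] V) (T : Plane →L[ℝ] Plane) (i : Fin 2) :
    D (T (coordVec i)) = ∑ k, jacobianMatrix T k i • D (coordVec k) := by
  conv_lhs => rw [eq_sum_coordVec (T (coordVec i))]
  simp [jacobianMatrix]

/-- The Gram matrix of the images of the standard basis vectors under `D : ℝ² → ℝ³`. -/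
def pullGram (D : Plane →L[ℝ] Space) : Matrix (Fin 2) (Fin 2) ℝ :=
  Matrix.gram ℝ fun i => D (coordVec i)

/-- The Gram matrix is transformed by congruence with the Jacobian matrix. -/
theorem pullGram_comp (D : Plane →L[ℝ] Space) (T : Plane →L[ℝ] Plane) :
    pullGram (D.comp T) = (jacobianMatrix T)ᵀ * pullGram D * jacobianMatrix T := by
  ext i j
  simp only [pullGram, Matrix.gram_apply, ContinuousLinearMap.comp_apply, apply_map_coordVec D T,
    inner_add_left, inner_add_right, real_inner_smul_left, real_inner_smul_right, Matrix.mul_apply,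
    Matrix.transpose_apply, Fin.sum_univ_two]
  ring

theorem transpose_pullGram (D : Plane →L[ℝ] Space) : (pullGram D)ᵀ = pullGram D := by
  ext i j
  exact real_inner_comm (D (coordVec i)) (D (coordVec j))

theorem det_pullGram_pos {D : Plane →L[ℝ] Space} (hD : Function.Injective D) :
    0 < (pullGram D).det := by
  refine (Matrix.posDef_gram_of_linearIndependent ?_).det_pos
  have h : LinearIndependent ℝ (coordVec : Fin 2 → Plane) := by
    have hb := (EuclideanSpace.basisFun (Fin 2) ℝ).toBasis.linearIndependent
    have he : ((EuclideanSpace.basisFun (Fin 2) ℝ).toBasis : Fin 2 → Plane) = coordVec := by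
      ext i j
      simp [coordVec]
    rwa [he] at hb
  exact h.map' (D : Plane →ₗ[ℝ] Space) (LinearMap.ker_eq_bot.2 hD)

/-- The scalar product of two covectors with respect to the metric of matrix `G`. -/
def dualInner (G : Matrix (Fin 2) (Fin 2) ℝ) (a b : Fin 2 → ℝ) : ℝ := a ⬝ᵥ (G⁻¹ *ᵥ b)

/-- The scalar product of covectors is invariant under the change of basis of matrix `P`. -/
theorem dualInner_congr_basis (G P : Matrix (Fin 2) (Fin 2) ℝ) (hP : P.det ≠ 0) (a b : Fin 2 → ℝ) :
    dualInner (Pᵀ * G * P) (Pᵀ *ᵥ a) (Pᵀ *ᵥ b) = dualInner G a b := by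
  have hu : IsUnit P.det := hP.isUnit
  have hut : IsUnit Pᵀ.det := by rwa [Matrix.det_transpose]
  rw [dualInner, dualInner, Matrix.mul_inv_rev, Matrix.mul_inv_rev, Matrix.mulVec_mulVec,
    Matrix.mul_assoc, Matrix.mul_assoc, Matrix.nonsing_inv_mul _ hut, Matrix.mul_one,
    Matrix.dotProduct_mulVec, ← Matrix.vecMul_vecMul, Matrix.mulVec_transpose,
    Matrix.vecMul_vecMul _ P, Matrix.mul_nonsing_inv _ hu, Matrix.vecMul_one,
    Matrix.dotProduct_mulVec]

theorem dualInner_comm {G : Matrix (Fin 2) (Fin 2) ℝ} (hG : Gᵀ = G) (a b : Fin 2 → ℝ) :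
    dualInner G a b = dualInner G b a := by
  have h : (G⁻¹)ᵀ = G⁻¹ := by rw [Matrix.transpose_nonsing_inv, hG]
  rw [dualInner, dualInner, Matrix.dotProduct_mulVec, ← Matrix.mulVec_transpose, h,
    dotProduct_comm]

/-! ### Derivatives in charts -/

section Charts

variable {H : Type*} [TopologicalSpace H] {I : ModelWithCorners ℝ Plane H}
  {M : Type*} [TopologicalSpace M] [ChartedSpace H M]
  {V : Type*} [NormedAddCommGroup V] [NormedSpace ℝ V]

theorem mfderiv_eq_fderivWithin {u : M → V} (hu : ContMDiff I 𝓘(ℝ, V) ∞ u) (p : M) :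
    mfderiv I 𝓘(ℝ, V) u p =
      fderivWithin ℝ (u ∘ (extChartAt I p).symm) (range I) (extChartAt I p p) := by
  exact (hu.mdifferentiable (by simp) p).mfderiv

section Target

variable {c : M} {F : Plane → V}

theorem differentiableWithinAt_range (hF : ContDiffOn ℝ ∞ F (extChartAt I c).target) {x : Plane}
    (hx : x ∈ (extChartAt I c).target) : DifferentiableWithinAt ℝ F (range I) x :=
  ((hF.differentiableOn (by simp)) x hx).mono_of_mem_nhdsWithin
    (extChartAt_target_mem_nhdsWithin_of_mem hx)

theorem contDiffOn_fderivWithin_range (hF : ContDiffOn ℝ ∞ F (extChartAt I c).target) :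
    ContDiffOn ℝ ∞ (fderivWithin ℝ F (range I)) (extChartAt I c).target := by
  refine (hF.fderivWithin (uniqueDiffOn_extChartAt_target c) (m := ∞) (by simp)).congr
    fun x hx => ?_
  exact (fderivWithin_subset (extChartAt_target_subset_range c)
    (uniqueDiffOn_extChartAt_target c x hx) (differentiableWithinAt_range hF hx)).symm

theorem contDiffOn_partialDeriv (hF : ContDiffOn ℝ ∞ F (extChartAt I c).target) (i : Fin 2) :
    ContDiffOn ℝ ∞ (partialDeriv I F i) (extChartAt I c).target :=
  (contDiffOn_fderivWithin_range hF).clm_apply contDiffOn_const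

end Target

variable [IsManifold I ∞ M]

theorem contDiffOn_comp_extChartAt_symm {u : M → V} (hu : ContMDiff I 𝓘(ℝ, V) ∞ u) (c : M) :
    ContDiffOn ℝ ∞ (u ∘ (extChartAt I c).symm) (extChartAt I c).target :=
  contMDiffOn_iff_contDiffOn.1
    (hu.contMDiffOn.comp (t := univ) (contMDiffOn_extChartAt_symm c) (fun _ _ => mem_univ _))

/-- The chain rule for two charts: the linear map that relates the derivatives of `u` in the charts
does not depend on `u`. It holds at boundary points too. -/
theorem fderivWithin_comp_tangentCoordChange {u : M → V} (hu : ContMDiff I 𝓘(ℝ, V) ∞ u)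
    {c d p : M} (hc : p ∈ (extChartAt I c).source) (hd : p ∈ (extChartAt I d).source) :
    fderivWithin ℝ (u ∘ (extChartAt I c).symm) (range I) (extChartAt I c p) =
      (fderivWithin ℝ (u ∘ (extChartAt I d).symm) (range I) (extChartAt I d p)).comp
        (tangentCoordChange I c d p) := by
  have hT := hasFDerivWithinAt_tangentCoordChange (I := I) ⟨hc, hd⟩
  have hxy : (extChartAt I d ∘ (extChartAt I c).symm) (extChartAt I c p) = extChartAt I d p := by
    rw [Function.comp_apply, (extChartAt I c).left_inv hc]
  have hD := (differentiableWithinAt_range (contDiffOn_comp_extChartAt_symm hu d)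
    ((extChartAt I d).map_source hd)).hasFDerivWithinAt
  rw [← hxy] at hD
  have hcomp := hD.comp (t := range I) (s := (extChartAt I c).target) _
    (hT.mono (extChartAt_target_subset_range c)) ?_
  · rw [hxy] at hcomp
    have hmem := extChartAt_target_mem_nhdsWithin' (I := I) hc
    have hcomp' := hcomp.mono_of_mem_nhdsWithin hmem
    refine (HasFDerivWithinAt.congr_of_eventuallyEq hcomp' ?_ ?_).fderivWithin
      (I.uniqueDiffOn _ (extChartAt_target_subset_range c ((extChartAt I c).map_source hc)))
    · have hpre : (extChartAt I c).symm ⁻¹' (extChartAt I d).source ∈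
          𝓝[range I] (extChartAt I c p) :=
        mem_nhdsWithin_of_mem_nhds (extChartAt_preimage_mem_nhds' hc
          (extChartAt_source_mem_nhds' hd))
      filter_upwards [hpre] with y hy
      simp only [Function.comp_apply, (extChartAt I d).left_inv hy]
    · simp only [Function.comp_apply, (extChartAt I c).left_inv hc, (extChartAt I d).left_inv hd]
  · intro y _
    simp

theorem injective_tangentCoordChange {c d p : M} (hc : p ∈ (extChartAt I c).source)
    (hd : p ∈ (extChartAt I d).source) : Function.Injective (tangentCoordChange I c d p) := by
  have h : Function.LeftInverse (tangentCoordChange I d c p) (tangentCoordChange I c d p) :=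
    fun v => by
      rw [tangentCoordChange_comp ⟨⟨hc, hd⟩, hc⟩, tangentCoordChange_self hc]
  exact h.injective

theorem det_tangentCoordChange_ne_zero {c d p : M} (hc : p ∈ (extChartAt I c).source)
    (hd : p ∈ (extChartAt I d).source) : (tangentCoordChange I c d p).det ≠ 0 := by
  have h : Function.Injective (tangentCoordChange I c d p : Plane →ₗ[ℝ] Plane) :=
    injective_tangentCoordChange hc hd
  intro h0
  exact (LinearMap.bot_lt_ker_of_det_eq_zero (f := (tangentCoordChange I c d p : Plane →ₗ[ℝ] Plane))
    h0).ne' (LinearMap.ker_eq_bot.2 h)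

/-- The partial derivatives of `u` in the preferred chart at `c`, at the point of `M` with
coordinate `x`. -/
def coordDiff (I : ModelWithCorners ℝ Plane H) (u : M → ℝ) (c : M) (x : Plane) : Fin 2 → ℝ :=
  fun j => partialDeriv I (u ∘ (extChartAt I c).symm) j x

theorem coordDiff_eq_mulVec {u : M → ℝ} (hu : ContMDiff I 𝓘(ℝ, ℝ) ∞ u)
    {c d p : M} (hc : p ∈ (extChartAt I c).source) (hd : p ∈ (extChartAt I d).source) :
    coordDiff I u c (extChartAt I c p) =
      (jacobianMatrix (tangentCoordChange I c d p))ᵀ *ᵥ coordDiff I u d (extChartAt I d p) := by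
  ext i
  simp only [coordDiff, partialDeriv, fderivWithin_comp_tangentCoordChange hu hc hd,
    ContinuousLinearMap.comp_apply, apply_map_coordVec, smul_eq_mul, Matrix.mulVec, dotProduct,
    Matrix.transpose_apply]

theorem coordGram_eq_mul {f : M → Space} (hf : ContMDiff I 𝓘(ℝ, Space) ∞ f)
    {c d p : M} (hc : p ∈ (extChartAt I c).source) (hd : p ∈ (extChartAt I d).source) :
    coordGram I f c (extChartAt I c p) =
      (jacobianMatrix (tangentCoordChange I c d p))ᵀ * coordGram I f d (extChartAt I d p) *
        jacobianMatrix (tangentCoordChange I c d p) := by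
  have h := pullGram_comp
    (fderivWithin ℝ (f ∘ (extChartAt I d).symm) (range I) (extChartAt I d p))
    (tangentCoordChange I c d p)
  rw [← fderivWithin_comp_tangentCoordChange hf hc hd] at h
  exact h

theorem det_coordGram_eq_mul {f : M → Space} (hf : ContMDiff I 𝓘(ℝ, Space) ∞ f)
    {c d p : M} (hc : p ∈ (extChartAt I c).source) (hd : p ∈ (extChartAt I d).source) :
    (coordGram I f c (extChartAt I c p)).det =
      (tangentCoordChange I c d p).det ^ 2 * (coordGram I f d (extChartAt I d p)).det := by
  rw [coordGram_eq_mul hf hc hd, Matrix.det_mul, Matrix.det_mul, Matrix.det_transpose,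
    det_jacobianMatrix]
  ring

omit [IsManifold I ∞ M] in
theorem gramMatrix_eq_coordGram {f : M → Space} (hf : ContMDiff I 𝓘(ℝ, Space) ∞ f) (p : M) :
    gramMatrix I f p = coordGram I f p (extChartAt I p p) := by
  ext i j
  simp only [gramMatrix, inducedMetric, mfderiv_eq_fderivWithin hf]
  rfl

omit [IsManifold I ∞ M] in
theorem transpose_coordGram (f : M → Space) (c : M) (x : Plane) :
    (coordGram I f c x)ᵀ = coordGram I f c x :=
  transpose_pullGram _

theorem det_coordGram_pos {f : M → Space} (hf : IsSmoothImmersion I f) {c : M} {x : Plane}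
    (hx : x ∈ (extChartAt I c).target) : 0 < (coordGram I f c x).det := by
  set p := (extChartAt I c).symm x with hp
  have hc : p ∈ (extChartAt I c).source := (extChartAt I c).map_target hx
  have hpx : extChartAt I c p = x := (extChartAt I c).right_inv hx
  have hinj : Function.Injective
      (fderivWithin ℝ (f ∘ (extChartAt I c).symm) (range I) (extChartAt I c p)) := by
    rw [fderivWithin_comp_tangentCoordChange hf.smooth hc (mem_extChartAt_source p)]
    have h := hf.injective_mfderiv p
    rw [mfderiv_eq_fderivWithin hf.smooth] at h
    exact h.comp (injective_tangentCoordChange hc (mem_extChartAt_source p))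
  rw [hpx] at hinj
  exact det_pullGram_pos hinj

/-- The area ratio can be computed in any chart, since both determinants are multiplied by the
square of the Jacobian determinant. -/
theorem areaRatio_eq_coordGram {f₁ f₂ : M → Space} (h₁ : ContMDiff I 𝓘(ℝ, Space) ∞ f₁)
    (h₂ : ContMDiff I 𝓘(ℝ, Space) ∞ f₂) {c p : M} (hc : p ∈ (extChartAt I c).source) :
    areaRatio I f₁ f₂ p = √((coordGram I f₁ c (extChartAt I c p)).det /
      (coordGram I f₂ c (extChartAt I c p)).det) := by
  have hp := mem_extChartAt_source (I := I) p
  rw [areaRatio, gramMatrix_eq_coordGram h₁, gramMatrix_eq_coordGram h₂,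
    det_coordGram_eq_mul h₁ hc hp, det_coordGram_eq_mul h₂ hc hp,
    mul_div_mul_left _ _ (pow_ne_zero 2 (det_tangentCoordChange_ne_zero hc hp))]

/-- The scalar product of the gradients of `u` and `v` is `∑ g^{ij} ∂ᵢu ∂ⱼv` in any chart, not only
in the preferred chart at the point. -/
theorem gradInner_eq_dualInner {f : M → Space} (hf : IsSmoothImmersion I f) {u v : M → ℝ}
    (hu : ContMDiff I 𝓘(ℝ, ℝ) ∞ u) (hv : ContMDiff I 𝓘(ℝ, ℝ) ∞ v) {c p : M}
    (hc : p ∈ (extChartAt I c).source) :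
    gradInner I f u v p = dualInner (coordGram I f c (extChartAt I c p))
      (coordDiff I u c (extChartAt I c p)) (coordDiff I v c (extChartAt I c p)) := by
  have hp := mem_extChartAt_source (I := I) p
  have hdet : (jacobianMatrix (tangentCoordChange I c p p)).det ≠ 0 := by
    rw [det_jacobianMatrix]; exact det_tangentCoordChange_ne_zero hc hp
  rw [coordGram_eq_mul hf.smooth hc hp, coordDiff_eq_mulVec hu hc hp, coordDiff_eq_mulVec hv hc hp,
    dualInner_congr_basis _ _ hdet]
  set G := coordGram I f p (extChartAt I p p) with hG
  have hpos : 0 < G.det := det_coordGram_pos hf (mem_extChartAt_target p)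
  -- the metric evaluated on two vectors given by their components
  have key : ∀ a b : Fin 2 → ℝ, inducedMetric I f p (WithLp.toLp 2 a : Plane)
      (WithLp.toLp 2 b : Plane) = a ⬝ᵥ (G *ᵥ b) := by
    intro a b
    unfold inducedMetric
    rw [mfderiv_eq_fderivWithin hf.smooth]
    change @inner ℝ Space _ (fderivWithin ℝ (f ∘ (extChartAt I p).symm) (range I) (extChartAt I p p)
      (WithLp.toLp 2 a : Plane)) (fderivWithin ℝ (f ∘ (extChartAt I p).symm) (range I)
        (extChartAt I p p) (WithLp.toLp 2 b : Plane)) = _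
    rw [eq_sum_coordVec (WithLp.toLp 2 a : Plane), eq_sum_coordVec (WithLp.toLp 2 b : Plane)]
    simp only [map_add, map_smul, inner_add_left, inner_add_right, real_inner_smul_left,
      real_inner_smul_right, Fin.sum_univ_two, dotProduct, Matrix.mulVec, hG, coordGram,
      partialDeriv, Matrix.of_apply]
    ring
  have hgrad : ∀ w : M → ℝ, ContMDiff I 𝓘(ℝ, ℝ) ∞ w →
      metricGradient I f w p =
        (WithLp.toLp 2 (G⁻¹ *ᵥ coordDiff I w p (extChartAt I p p)) : Plane) := by
    intro w hw
    rw [metricGradient, gramMatrix_eq_coordGram hf.smooth, mfderiv_eq_fderivWithin hw]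
    rfl
  rw [gradInner, hgrad u hu, hgrad v hv, key, Matrix.mulVec_mulVec,
    Matrix.mul_nonsing_inv _ hpos.ne'.isUnit, Matrix.one_mulVec, dotProduct_comm]
  exact dualInner_comm (transpose_coordGram f p _) _ _

end Charts

/-! ### Integration by parts on a convex set -/

section Convex

variable {E : Type*} [NormedAddCommGroup E] [NormedSpace ℝ E]

theorem exists_mem_segment_frontier {R : Set E} {x y : E} (hx : x ∈ R) (hy : y ∉ R) :
    ∃ z ∈ segment ℝ x y, z ∈ frontier R := by
  have hconn : IsPreconnected (segment ℝ x y) := (convex_segment x y).isPreconnected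
  by_contra! h
  have hcover : segment ℝ x y ⊆ interior R ∪ (closure R)ᶜ := fun z hz => by
    by_cases hi : z ∈ interior R
    · exact Or.inl hi
    · exact Or.inr fun hc => h z hz ⟨hc, hi⟩
  obtain ⟨z, -, hz1, hz2⟩ := hconn _ _ isOpen_interior isClosed_closure.isOpen_compl hcover
    ⟨x, left_mem_segment ℝ x y, (hcover (left_mem_segment ℝ x y)).resolve_right
      fun hc => hc (subset_closure hx)⟩
    ⟨y, right_mem_segment ℝ x y, (hcover (right_mem_segment ℝ x y)).resolve_left
      fun hi => hy (interior_subset hi)⟩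
  exact hz2 (subset_closure (interior_subset hz1))

/-- A Lipschitz function on `R` that vanishes on the frontier of `R` remains Lipschitz, with the
same constant, when it is extended by zero. -/
theorem lipschitzWith_indicator {R : Set E} {F : E → ℝ} {C : NNReal}
    (hF : LipschitzOnWith C F R) (hR : IsClosed R) (h0 : ∀ x ∈ frontier R, F x = 0) :
    LipschitzWith C (R.indicator F) := by
  have aux : ∀ x ∈ R, ∀ y ∉ R, dist (F x) 0 ≤ C * dist x y := by
    intro x hx y hy
    obtain ⟨z, hz, hzf⟩ := exists_mem_segment_frontier hx hy
    calc dist (F x) 0 = dist (F x) (F z) := by rw [h0 z hzf]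
      _ ≤ C * dist x z := hF.dist_le_mul x hx z (hR.frontier_subset hzf)
      _ ≤ C * dist x y := by
        gcongr
        rw [← dist_add_dist_of_mem_segment hz]
        exact le_add_of_nonneg_right dist_nonneg
  refine LipschitzWith.of_dist_le_mul fun x y => ?_
  by_cases hx : x ∈ R <;> by_cases hy : y ∈ R
  · simpa [hx, hy] using hF.dist_le_mul x hx y hy
  · simpa only [indicator_of_mem hx, indicator_of_notMem hy] using aux x hx y hy
  · rw [indicator_of_mem hy, indicator_of_notMem hx, dist_comm, dist_comm x y]
    exact aux y hy x hx
  · simp only [indicator_of_notMem hx, indicator_of_notMem hy, dist_self]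
    positivity

theorem fderivWithin_eq_zero_of_eqOn_compl {R K : Set E} (hK : IsClosed K)
    {V : Type*} [NormedAddCommGroup V] [NormedSpace ℝ V] {F : E → V}
    (h0 : ∀ x ∈ R, x ∉ K → F x = 0) {x : E} (hx : x ∈ R) (hxK : x ∉ K) :
    fderivWithin ℝ F R x = 0 := by
  have h : F =ᶠ[𝓝[R] x] fun _ => (0 : V) := by
    filter_upwards [self_mem_nhdsWithin, mem_nhdsWithin_of_mem_nhds (hK.isOpen_compl.mem_nhds hxK)]
      with y hy hyK using h0 y hy hyK
  rw [h.fderivWithin_eq (h0 x hx hxK)]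
  simp

variable [FiniteDimensional ℝ E] [MeasurableSpace E] [BorelSpace E]

/-- The integral over a convex set of a directional derivative of a compactly supported function
that vanishes on the frontier is zero. No regularity of the frontier is needed: the extension of
the function by zero is Lipschitz, and the frontier is negligible. -/
theorem integral_fderivWithin_apply_eq_zero (μ : Measure E) [μ.IsAddHaarMeasure] {R K : Set E}
    (hR : IsClosed R) (hconv : Convex ℝ R) (hne : (interior R).Nonempty) {F : E → ℝ}
    (hF : ContDiffOn ℝ 1 F R) (hK : IsCompact K) (hK0 : ∀ x ∈ R, x ∉ K → F x = 0)
    (h0 : ∀ x ∈ frontier R, F x = 0) (v : E) :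
    ∫ x in R, fderivWithin ℝ F R x v ∂μ = 0 := by
  have hud : UniqueDiffOn ℝ R := uniqueDiffOn_convex hconv hne
  have hcont : ContinuousOn (fderivWithin ℝ F R) R :=
    hF.continuousOn_fderivWithin hud (by simp)
  obtain ⟨C, hC⟩ : ∃ C, ∀ x ∈ R ∩ K, ‖fderivWithin ℝ F R x‖ ≤ C :=
    (hK.inter_left hR).exists_bound_of_continuousOn (hcont.mono inter_subset_left)
  have hlip : LipschitzOnWith (Real.toNNReal C) F R := by
    refine hconv.lipschitzOnWith_of_nnnorm_fderivWithin_le (hF.differentiableOn (by simp))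
      fun x hx => ?_
    by_cases hxK : x ∈ K
    · exact (norm_toNNReal (a := fderivWithin ℝ F R x)).symm.le.trans
        (Real.toNNReal_le_toNNReal (hC x ⟨hx, hxK⟩))
    · rw [fderivWithin_eq_zero_of_eqOn_compl hK.isClosed hK0 hx hxK]
      simp
  have hG := lipschitzWith_indicator hlip hR h0
  have hGc : HasCompactSupport (R.indicator F) := by
    refine HasCompactSupport.intro hK fun x hx => ?_
    by_cases hxR : x ∈ R
    · rw [indicator_of_mem hxR, hK0 x hxR hx]
    · rw [indicator_of_notMem hxR]
  have hint := (LipschitzWith.const (1 : ℝ)).integral_lineDeriv_mul_eq (μ := μ) hG hGc (-v)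
  simp only [neg_neg, mul_one] at hint
  have hz : ∀ x : E, lineDeriv ℝ (fun _ : E => (1 : ℝ)) x (-v) = 0 := fun x => by
    simp [lineDeriv]
  simp only [hz, zero_mul, integral_zero] at hint
  rw [hint, ← integral_indicator hR.measurableSet]
  refine integral_congr_ae ?_
  have hfr : ∀ᵐ x ∂μ, x ∉ frontier R := by
    rw [ae_iff]
    simpa using hconv.addHaar_frontier μ
  filter_upwards [hfr] with x hx
  by_cases hxR : x ∈ R
  · have hxi : R ∈ 𝓝 x := mem_interior_iff_mem_nhds.1 (by
      by_contra hi
      exact hx ⟨subset_closure hxR, hi⟩)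
    have hev : R.indicator F =ᶠ[𝓝 x] F := by
      filter_upwards [hxi] with y hy using indicator_of_mem hy F
    rw [indicator_of_mem hxR, hev.lineDeriv_eq, fderivWithin_of_mem_nhds hxi]
    exact ((((hF.differentiableOn (by simp)) x hxR).differentiableAt hxi).lineDeriv_eq_fderiv).symm
  · have hev : R.indicator F =ᶠ[𝓝 x] fun _ => (0 : ℝ) := by
      filter_upwards [hR.isOpen_compl.mem_nhds hxR] with y hy using indicator_of_notMem hy F
    rw [indicator_of_notMem hxR, hev.lineDeriv_eq]
    simp [lineDeriv]

theorem integrableOn_of_continuousOn_of_eq_zero {μ : Measure E} [IsLocallyFiniteMeasure μ]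
    {s K : Set E} {g : E → ℝ} (hg : ContinuousOn g s) (hs : MeasurableSet s) (hK : IsCompact K)
    (hKs : K ⊆ s) (h0 : ∀ x ∈ s, x ∉ K → g x = 0) : IntegrableOn g s μ :=
  ((hg.mono hKs).integrableOn_compact hK).of_forall_sdiff_eq_zero hs fun x hx => h0 x hx.1 hx.2

end Convex

/-! ### Regularity of the coordinate expressions -/

section Charts

variable {H : Type*} [TopologicalSpace H] {I : ModelWithCorners ℝ Plane H}
  {M : Type*} [TopologicalSpace M] [ChartedSpace H M]

theorem measurableSet_extChartAt_target (I : ModelWithCorners ℝ Plane H) (c : M) :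
    MeasurableSet (extChartAt I c).target := by
  rw [extChartAt_target]
  exact ((((chartAt H c).open_target).preimage I.continuous_symm).measurableSet).inter
    I.isClosed_range.measurableSet

theorem partialDeriv_mul {c : M} {F G : Plane → ℝ}
    (hF : ContDiffOn ℝ ∞ F (extChartAt I c).target) (hG : ContDiffOn ℝ ∞ G (extChartAt I c).target)
    (i : Fin 2) {x : Plane} (hx : x ∈ (extChartAt I c).target) :
    partialDeriv I (fun y => F y * G y) i x =
      partialDeriv I F i x * G x + F x * partialDeriv I G i x := by
  have h := fderivWithin_mul (I.uniqueDiffOn x (extChartAt_target_subset_range c hx))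
    (differentiableWithinAt_range hF hx) (differentiableWithinAt_range hG hx)
  rw [partialDeriv, show (fun y => F y * G y) = F * G from rfl, h]
  simp [partialDeriv]
  ring

/-- Integration by parts in a chart. -/
theorem integral_partialDeriv_mul_eq_neg {c : M} {W b : Plane → ℝ}
    (hW : ContDiffOn ℝ ∞ W (extChartAt I c).target)
    (hb : ContDiffOn ℝ ∞ b (extChartAt I c).target) {K : Set Plane} (hK : IsCompact K)
    (hKt : K ⊆ (extChartAt I c).target) (hK0 : ∀ x ∈ (extChartAt I c).target, x ∉ K → b x = 0)
    (hfr : ∀ x ∈ (extChartAt I c).target, x ∈ frontier (range I) → b x = 0) (i : Fin 2) :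
    IntegrableOn (fun x => partialDeriv I W i x * b x) (extChartAt I c).target ∧
    IntegrableOn (fun x => W x * partialDeriv I b i x) (extChartAt I c).target ∧
    ∫ x in (extChartAt I c).target, partialDeriv I W i x * b x =
      -∫ x in (extChartAt I c).target, W x * partialDeriv I b i x := by
  set t := (extChartAt I c).target with ht
  have htm : MeasurableSet t := measurableSet_extChartAt_target I c
  have htr : t ⊆ range I := extChartAt_target_subset_range c
  have hnhds : ∀ x ∈ t, t ∈ 𝓝[range I] x := fun x hx =>
    extChartAt_target_mem_nhdsWithin_of_mem hx
  have hdb0 : ∀ x ∈ t, x ∉ K → partialDeriv I b i x = 0 := by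
    intro x hx hxK
    have h : b =ᶠ[𝓝[range I] x] fun _ => (0 : ℝ) := by
      filter_upwards [hnhds x hx,
        mem_nhdsWithin_of_mem_nhds (hK.isClosed.isOpen_compl.mem_nhds hxK)]
        with y hy hyK using hK0 y hy hyK
    rw [partialDeriv, h.fderivWithin_eq (hK0 x hx hxK)]
    simp
  have hint1 : IntegrableOn (fun x => partialDeriv I W i x * b x) t :=
    integrableOn_of_continuousOn_of_eq_zero
      ((contDiffOn_partialDeriv hW i).continuousOn.mul hb.continuousOn) htm hK hKt
      fun x hx hxK => by rw [hK0 x hx hxK, mul_zero]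
  have hint2 : IntegrableOn (fun x => W x * partialDeriv I b i x) t :=
    integrableOn_of_continuousOn_of_eq_zero
      (hW.continuousOn.mul (contDiffOn_partialDeriv hb i).continuousOn) htm hK hKt
      fun x hx hxK => by rw [hdb0 x hx hxK, mul_zero]
  refine ⟨hint1, hint2, ?_⟩
  -- the product, extended by zero outside of the chart
  set F : Plane → ℝ := t.indicator fun x => W x * b x with hFdef
  have hF0 : ∀ x, x ∉ K → F x = 0 := by
    intro x hxK
    by_cases hx : x ∈ t
    · rw [hFdef, indicator_of_mem hx, hK0 x hx hxK, mul_zero]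
    · rw [hFdef, indicator_of_notMem hx]
  have hFt : ∀ x ∈ t, F =ᶠ[𝓝[range I] x] fun x => W x * b x := fun x hx => by
    filter_upwards [hnhds x hx] with y hy using indicator_of_mem hy _
  have hFsmooth : ContDiffOn ℝ 1 F (range I) := by
    intro x hx
    by_cases hxK : x ∈ K
    · have h1 : ContDiffWithinAt ℝ 1 (fun x => W x * b x) (range I) x :=
        (((hW.mul hb) x (hKt hxK)).mono_of_mem_nhdsWithin (hnhds x (hKt hxK))).of_le (by simp)
      exact h1.congr_of_eventuallyEq (hFt x (hKt hxK)) (indicator_of_mem (hKt hxK) _)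
    · have h1 : F =ᶠ[𝓝 x] fun _ => (0 : ℝ) := by
        filter_upwards [hK.isClosed.isOpen_compl.mem_nhds hxK] with y hy using hF0 y hy
      exact (contDiffAt_const.congr_of_eventuallyEq h1).contDiffWithinAt
  have hzero := integral_fderivWithin_apply_eq_zero volume I.isClosed_range I.convex_range
    I.nonempty_interior hFsmooth hK (fun x _ => hF0 x) (fun x hx => by
      by_cases hxt : x ∈ t
      · rw [hFdef, indicator_of_mem hxt, hfr x hxt hx, mul_zero]
      · rw [hFdef, indicator_of_notMem hxt]) (coordVec i)
  rw [setIntegral_eq_of_subset_of_forall_sdiff_eq_zero I.isClosed_range.measurableSet htr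
    (fun x hx => by
      rw [fderivWithin_eq_zero_of_eqOn_compl hK.isClosed (fun y _ => hF0 y) hx.1
        (fun hxK => hx.2 (hKt hxK))]
      simp), setIntegral_congr_fun htm (g := fun x => partialDeriv I W i x * b x +
        W x * partialDeriv I b i x) (fun x hx => by
      beta_reduce
      rw [← partialDeriv_mul hW hb i hx, partialDeriv]
      exact congrArg (fun D : Plane →L[ℝ] ℝ => D (coordVec i))
        ((hFt x hx).fderivWithin_eq (indicator_of_mem hx _))), integral_add hint1 hint2] at hzero
  linarith

theorem contDiffOn_coordGram_apply [IsManifold I ∞ M] {f : M → Space}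
    (hf : ContMDiff I 𝓘(ℝ, Space) ∞ f) (c : M)
    (i j : Fin 2) : ContDiffOn ℝ ∞ (fun x => coordGram I f c x i j) (extChartAt I c).target :=
  (contDiffOn_partialDeriv (contDiffOn_comp_extChartAt_symm hf c) i).inner ℝ
    (contDiffOn_partialDeriv (contDiffOn_comp_extChartAt_symm hf c) j)

theorem contDiffOn_det_coordGram [IsManifold I ∞ M] {f : M → Space}
    (hf : ContMDiff I 𝓘(ℝ, Space) ∞ f) (c : M) :
    ContDiffOn ℝ ∞ (fun x => (coordGram I f c x).det) (extChartAt I c).target := by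
  have h := contDiffOn_coordGram_apply hf c
  simp only [Matrix.det_fin_two]
  exact ((h 0 0).mul (h 1 1)).sub ((h 0 1).mul (h 1 0))

/-- The `i`-th component of the vector density `√|g| ∇u` in the preferred chart at `c`. -/
def coordFlux (I : ModelWithCorners ℝ Plane H) (f : M → Space) (u : M → ℝ) (c : M) (i : Fin 2)
    (x : Plane) : ℝ :=
  √(coordGram I f c x).det *
    ∑ j, (coordGram I f c x)⁻¹ i j * partialDeriv I (u ∘ (extChartAt I c).symm) j x

/-- The vector density `√|g| ∇u` applied to `v` is `√|g| g(∇v, ∇u)`. -/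
theorem sum_coordFlux_mul_partialDeriv (f : M → Space) (u v : M → ℝ) (c : M) (x : Plane) :
    ∑ i, coordFlux I f u c i x * partialDeriv I (v ∘ (extChartAt I c).symm) i x =
      √(coordGram I f c x).det *
        dualInner (coordGram I f c x) (coordDiff I v c x) (coordDiff I u c x) := by
  simp only [coordFlux, dualInner, dotProduct, Matrix.mulVec, coordDiff, Finset.mul_sum,
    Finset.sum_mul]
  exact Finset.sum_congr rfl fun i _ => Finset.sum_congr rfl fun j _ => by ring

variable [IsManifold I ∞ M] {f : M → Space} (hf : IsSmoothImmersion I f) (c : M)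
include hf

theorem contDiffOn_sqrt_det_coordGram :
    ContDiffOn ℝ ∞ (fun x => √(coordGram I f c x).det) (extChartAt I c).target :=
  (contDiffOn_det_coordGram hf.smooth c).sqrt fun _ hx => (det_coordGram_pos hf hx).ne'

theorem contDiffOn_inv_coordGram_apply (i j : Fin 2) :
    ContDiffOn ℝ ∞ (fun x => (coordGram I f c x)⁻¹ i j) (extChartAt I c).target := by
  have h := contDiffOn_coordGram_apply hf.smooth c
  have hd := (contDiffOn_det_coordGram hf.smooth c).inv fun _ hx => (det_coordGram_pos hf hx).ne'
  simp only [Matrix.inv_def, Ring.inverse_eq_inv', Matrix.smul_apply, smul_eq_mul,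
    Matrix.adjugate_fin_two]
  refine hd.mul ?_
  fin_cases i <;> fin_cases j
  · exact h 1 1
  · exact (h 0 1).neg
  · exact (h 1 0).neg
  · exact h 0 0

theorem sqrt_det_mul_coordLaplacian (u : M → ℝ) {x : Plane} (hx : x ∈ (extChartAt I c).target) :
    √(coordGram I f c x).det * coordLaplacian I f u c x =
      ∑ i, partialDeriv I (coordFlux I f u c i) i x :=
  mul_inv_cancel_left₀ (Real.sqrt_pos.2 (det_coordGram_pos hf hx)).ne' _

variable {u : M → ℝ} (hu : ContMDiff I 𝓘(ℝ, ℝ) ∞ u)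
include hu

theorem contDiffOn_coordFlux (i : Fin 2) :
    ContDiffOn ℝ ∞ (coordFlux I f u c i) (extChartAt I c).target :=
  (contDiffOn_sqrt_det_coordGram hf c).mul <| ContDiffOn.sum fun j _ =>
    (contDiffOn_inv_coordGram_apply hf c i j).mul
      (contDiffOn_partialDeriv (contDiffOn_comp_extChartAt_symm hu c) j)

theorem continuousOn_coordLaplacian :
    ContinuousOn (coordLaplacian I f u c) (extChartAt I c).target :=
  ((contDiffOn_sqrt_det_coordGram hf c).continuousOn.inv₀ fun _ hx =>
    (Real.sqrt_pos.2 (det_coordGram_pos hf hx)).ne').mul <|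
    continuousOn_finsetSum _ fun i _ =>
      (contDiffOn_partialDeriv (contDiffOn_coordFlux hf c hu i) i).continuousOn

end Charts

/-! ### Continuity of the area ratio and of the scalar product of gradients -/

section Continuity

variable {H : Type*} [TopologicalSpace H] {I : ModelWithCorners ℝ Plane H}
  {M : Type*} [TopologicalSpace M] [ChartedSpace H M]

theorem continuousOn_of_eq_comp_extChartAt {X : Type*} [TopologicalSpace X] {h : M → X} {c : M}
    {F : Plane → X} (hF : ContinuousOn F (extChartAt I c).target)
    (hh : ∀ p ∈ (extChartAt I c).source, h p = F (extChartAt I c p)) :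
    ContinuousOn h (extChartAt I c).source :=
  (hF.comp (continuousOn_extChartAt c) fun _ hp => (extChartAt I c).map_source hp).congr hh

theorem continuous_of_continuousOn_source {X : Type*} [TopologicalSpace X] {h : M → X}
    (hh : ∀ c : M, ContinuousOn h (extChartAt I c).source) : Continuous h :=
  continuous_iff_continuousAt.2 fun p => (hh p).continuousAt (extChartAt_source_mem_nhds p)

variable [IsManifold I ∞ M]

theorem continuous_areaRatio {f₁ f₂ : M → Space} (h₁ : IsSmoothImmersion I f₁)
    (h₂ : IsSmoothImmersion I f₂) : Continuous (areaRatio I f₁ f₂) :=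
  continuous_of_continuousOn_source fun c => continuousOn_of_eq_comp_extChartAt
    (((contDiffOn_det_coordGram h₁.smooth c).continuousOn.div
      (contDiffOn_det_coordGram h₂.smooth c).continuousOn
      fun _ hx => (det_coordGram_pos h₂ hx).ne').sqrt)
    fun _ hp => areaRatio_eq_coordGram h₁.smooth h₂.smooth hp

theorem areaRatio_mul_areaRatio {f₁ f₂ : M → Space} (h₁ : IsSmoothImmersion I f₁)
    (h₂ : IsSmoothImmersion I f₂) (p : M) : areaRatio I f₁ f₂ p * areaRatio I f₂ f₁ p = 1 := by
  have hp := mem_extChartAt_source (I := I) p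
  have p₁ := det_coordGram_pos h₁ ((extChartAt I p).map_source hp)
  have p₂ := det_coordGram_pos h₂ ((extChartAt I p).map_source hp)
  rw [areaRatio_eq_coordGram h₁.smooth h₂.smooth hp, areaRatio_eq_coordGram h₂.smooth h₁.smooth hp,
    ← Real.sqrt_mul (div_pos p₁ p₂).le, div_mul_div_cancel₀ p₂.ne', div_self p₁.ne', Real.sqrt_one]

theorem continuous_gradInner {f : M → Space} (hf : IsSmoothImmersion I f) {u v : M → ℝ}
    (hu : ContMDiff I 𝓘(ℝ, ℝ) ∞ u) (hv : ContMDiff I 𝓘(ℝ, ℝ) ∞ v) :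
    Continuous (gradInner I f u v) := by
  refine continuous_of_continuousOn_source fun c => continuousOn_of_eq_comp_extChartAt (c := c)
    (F := fun x => dualInner (coordGram I f c x) (coordDiff I u c x) (coordDiff I v c x)) ?_
    fun _ hp => gradInner_eq_dualInner hf hu hv hp
  have hd : ∀ {w : M → ℝ}, ContMDiff I 𝓘(ℝ, ℝ) ∞ w → ∀ j,
      ContinuousOn (fun x => coordDiff I w c x j) (extChartAt I c).target := fun hw j =>
    (contDiffOn_partialDeriv (contDiffOn_comp_extChartAt_symm hw c) j).continuousOn
  simp only [dualInner, dotProduct, Matrix.mulVec]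
  exact continuousOn_finsetSum _ fun i _ => (hd hu i).mul <| continuousOn_finsetSum _ fun j _ =>
    (contDiffOn_inv_coordGram_apply hf c i j).continuousOn.mul (hd hv j)

end Continuity

/-! ### The area measure -/

section Area

variable {H : Type*} [TopologicalSpace H] {I : ModelWithCorners ℝ Plane H}
  {M : Type*} [TopologicalSpace M] [ChartedSpace H M] [MeasurableSpace M] [BorelSpace M]

theorem measurableSet_extChartAt_source (I : ModelWithCorners ℝ Plane H) (c : M) :
    MeasurableSet (extChartAt I c).source :=
  (isOpen_extChartAt_source c).measurableSet

theorem measurableSet_target_inter_preimage (I : ModelWithCorners ℝ Plane H) (c : M) {s : Set M}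
    (hs : MeasurableSet s) :
    MeasurableSet ((extChartAt I c).target ∩ (extChartAt I c).symm ⁻¹' s) := by
  have h : Measurable ((extChartAt I c).target.domRestrict (extChartAt I c).symm) :=
    (continuousOn_iff_continuous_domRestrict.1 (continuousOn_extChartAt_symm c)).measurable
  have h2 := (measurableSet_extChartAt_target I c).subtype_image (h hs)
  convert h2 using 1
  ext x
  simp only [mem_inter_iff, mem_preimage, mem_image, Subtype.exists, domRestrict_apply]
  exact ⟨fun hx => ⟨x, hx.1, hx.2, rfl⟩, fun ⟨_, ha, has, hax⟩ => hax ▸ ⟨ha, has⟩⟩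

theorem aemeasurable_extChartAt_symm (I : ModelWithCorners ℝ Plane H) (c : M) :
    AEMeasurable (extChartAt I c).symm (volume.restrict (extChartAt I c).target) :=
  (continuousOn_extChartAt_symm c).aemeasurable (measurableSet_extChartAt_target I c)

theorem aemeasurable_extChartAt_symm_withDensity (I : ModelWithCorners ℝ Plane H) (c : M)
    (ρ : Plane → ENNReal) :
    AEMeasurable (extChartAt I c).symm
      ((volume.restrict (extChartAt I c).target).withDensity ρ) :=
  (aemeasurable_extChartAt_symm I c).mono_ac (withDensity_absolutelyContinuous _ _)

theorem chartArea_apply (f : M → Space) (c : M) {s : Set M} (hs : MeasurableSet s) :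
    chartArea I f c s = ∫⁻ x in (extChartAt I c).target ∩ (extChartAt I c).symm ⁻¹' s,
      ENNReal.ofReal √(coordGram I f c x).det := by
  rw [chartArea, Measure.map_apply_of_aemeasurable (aemeasurable_extChartAt_symm_withDensity I c _)
    hs, withDensity_apply', Measure.restrict_restrict' (measurableSet_extChartAt_target I c),
    inter_comm]

theorem chartArea_eq_of_inter_source (f : M → Space) (c : M) {s : Set M} (hs : MeasurableSet s) :
    chartArea I f c (s ∩ (extChartAt I c).source) = chartArea I f c s := by
  rw [chartArea_apply f c hs, chartArea_apply f c (hs.inter (measurableSet_extChartAt_source I c))]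
  congr 2
  ext x
  exact ⟨fun h => ⟨h.1, h.2.1⟩, fun h => ⟨h.1, h.2, (extChartAt I c).map_target h.1⟩⟩

theorem restrict_chartArea (f : M → Space) (c : M) :
    (chartArea I f c).restrict (extChartAt I c).source = chartArea I f c := by
  ext s hs
  rw [Measure.restrict_apply hs, chartArea_eq_of_inter_source f c hs]

variable [IsManifold I ∞ M]

/-- The area elements of two charts agree on the overlap: the square root of the Gram determinant
is multiplied by the modulus of the Jacobian of the coordinate change. -/
theorem chartArea_eq_chartArea {f : M → Space} (hf : ContMDiff I 𝓘(ℝ, Space) ∞ f) {c d : M}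
    {s : Set M} (hs : MeasurableSet s) (hc : s ⊆ (extChartAt I c).source)
    (hd : s ⊆ (extChartAt I d).source) : chartArea I f c s = chartArea I f d s := by
  rw [chartArea_apply f c hs, chartArea_apply f d hs]
  set S := (extChartAt I c).target ∩ (extChartAt I c).symm ⁻¹' s with hS
  have himage : (extChartAt I d).target ∩ (extChartAt I d).symm ⁻¹' s =
      (extChartAt I d ∘ (extChartAt I c).symm) '' S := by
    ext y
    constructor
    · rintro ⟨hy, hys⟩
      refine ⟨extChartAt I c ((extChartAt I d).symm y), ⟨(extChartAt I c).map_source (hc hys), ?_⟩,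
        ?_⟩
      · rwa [mem_preimage, (extChartAt I c).left_inv (hc hys)]
      · rw [Function.comp_apply, (extChartAt I c).left_inv (hc hys), (extChartAt I d).right_inv hy]
    · rintro ⟨x, ⟨_, hxs⟩, rfl⟩
      refine ⟨(extChartAt I d).map_source (hd hxs), ?_⟩
      rwa [mem_preimage, Function.comp_apply, (extChartAt I d).left_inv (hd hxs)]
  have hinj : InjOn (extChartAt I d ∘ (extChartAt I c).symm) S := by
    intro x hx y hy hxy
    exact (extChartAt I c).symm.injOn hx.1 hy.1 ((extChartAt I d).injOn (hd hx.2) (hd hy.2) hxy)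
  have hderiv : ∀ x ∈ S, HasFDerivWithinAt (extChartAt I d ∘ (extChartAt I c).symm)
      (tangentCoordChange I c d ((extChartAt I c).symm x)) S x := by
    intro x hx
    have h := hasFDerivWithinAt_tangentCoordChange (I := I) ⟨hc hx.2, hd hx.2⟩
    rw [(extChartAt I c).right_inv hx.1] at h
    exact h.mono fun y hy => extChartAt_target_subset_range c hy.1
  rw [himage, lintegral_image_eq_lintegral_abs_det_fderiv_mul volume
    (measurableSet_target_inter_preimage I c hs) hderiv hinj]
  refine setLIntegral_congr_fun (measurableSet_target_inter_preimage I c hs) fun x hx => ?_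
  have h := det_coordGram_eq_mul hf (hc hx.2) (hd hx.2)
  rw [(extChartAt I c).right_inv hx.1] at h
  rw [h, Real.sqrt_mul (sq_nonneg _), Real.sqrt_sq_eq_abs, ENNReal.ofReal_mul (abs_nonneg _)]
  rfl

theorem lintegral_chartArea {f : M → Space} (hf : IsSmoothImmersion I f) (c : M)
    {g : M → ENNReal} (hg : Measurable g) :
    ∫⁻ p, g p ∂(chartArea I f c) = ∫⁻ x in (extChartAt I c).target,
      ENNReal.ofReal √(coordGram I f c x).det * g ((extChartAt I c).symm x) := by
  rw [chartArea, lintegral_map' hg.aemeasurable (aemeasurable_extChartAt_symm_withDensity I c _)]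
  exact lintegral_withDensity_eq_lintegral_mul₀
    ((contDiffOn_sqrt_det_coordGram hf c).continuousOn.aemeasurable
      (measurableSet_extChartAt_target I c)).ennreal_ofReal
    (hg.comp_aemeasurable (aemeasurable_extChartAt_symm I c))

variable [SecondCountableTopology M]

/-- On the domain of a chart, the area measure is given by the area element of the chart. -/
theorem restrict_areaMeasure {f : M → Space} (hf : ContMDiff I 𝓘(ℝ, Space) ∞ f) (d : M) :
    (areaMeasure I f).restrict (extChartAt I d).source = chartArea I f d := by
  refine le_antisymm ?_ ?_
  swap
  · rw [← restrict_chartArea f d]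
    exact Measure.restrict_mono subset_rfl (le_iSup (chartArea I f) d)
  have : Nonempty M := ⟨d⟩
  obtain ⟨t, htc, htu⟩ := TopologicalSpace.countable_cover_nhds
    (fun c : M => extChartAt_source_mem_nhds (I := I) c)
  have htne : t.Nonempty := by
    obtain ⟨c, hc, -⟩ := mem_iUnion₂.1 (htu.symm ▸ mem_univ d)
    exact ⟨c, hc⟩
  obtain ⟨c, rfl⟩ := htc.exists_eq_range htne
  rw [biUnion_range] at htu
  -- a measurable partition subordinate to countably many charts
  set A := disjointed fun n => (extChartAt I (c n)).source with hA
  have hAm : ∀ n, MeasurableSet (A n) :=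
    MeasurableSet.disjointed fun n => measurableSet_extChartAt_source I (c n)
  have hAs : ∀ n, A n ⊆ (extChartAt I (c n)).source := disjointed_subset _
  have hAd : Pairwise (Function.onFun Disjoint A) := disjoint_disjointed _
  have hAu : ⋃ n, A n = univ := by rw [hA, iUnion_disjointed, htu]
  have hsum : ∀ (μ : Measure M) {s : Set M}, MeasurableSet s → μ s = ∑' n, μ (s ∩ A n) := by
    intro μ s hs
    rw [← measure_iUnion (fun i j hij => (hAd hij).mono inter_subset_right inter_subset_right)
      (fun n => hs.inter (hAm n)), ← inter_iUnion, hAu, inter_univ]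
  set ν : Measure M := Measure.sum fun n => (chartArea I f (c n)).restrict (A n) with hν
  have hνapply : ∀ {s : Set M}, MeasurableSet s → ν s = ∑' n, chartArea I f (c n) (s ∩ A n) := by
    intro s hs
    rw [hν, Measure.sum_apply _ hs]
    exact tsum_congr fun n => Measure.restrict_apply hs
  have hle : areaMeasure I f ≤ ν := by
    refine iSup_le fun e => Measure.le_intro fun s hs _ => ?_
    have hse := hs.inter (measurableSet_extChartAt_source I e)
    rw [← chartArea_eq_of_inter_source f e hs, hsum _ hse, hνapply hs]
    refine ENNReal.tsum_le_tsum fun n => ?_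
    rw [chartArea_eq_chartArea hf (d := c n) (hse.inter (hAm n))
      (fun p hp => hp.1.2) (fun p hp => hAs n hp.2)]
    exact measure_mono (inter_subset_inter_left _ inter_subset_left)
  refine (Measure.restrict_mono subset_rfl hle).trans (Measure.le_intro fun s hs _ => ?_)
  have hsd := hs.inter (measurableSet_extChartAt_source I d)
  rw [Measure.restrict_apply hs, hνapply hsd, ← chartArea_eq_of_inter_source f d hs, hsum _ hsd]
  refine (tsum_congr fun n => ?_).le
  exact chartArea_eq_chartArea hf (hsd.inter (hAm n)) (fun p hp => hAs n hp.2) (fun p hp => hp.1.2)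

theorem isLocallyFiniteMeasure_areaMeasure {f : M → Space} (hf : IsSmoothImmersion I f) :
    IsLocallyFiniteMeasure (areaMeasure I f) := by
  have := Manifold.locallyCompact_of_finiteDimensional (M := M) I
  refine ⟨fun p => ?_⟩
  obtain ⟨K, hKp, hKs, hK⟩ := local_compact_nhds (extChartAt_source_mem_nhds (I := I) p)
  refine ⟨interior K, interior_mem_nhds.2 hKp, ?_⟩
  have hKs' : interior K ⊆ (extChartAt I p).source := interior_subset.trans hKs
  have hm : MeasurableSet (interior K) := isOpen_interior.measurableSet
  have himage : IsCompact (extChartAt I p '' K) :=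
    hK.image_of_continuousOn ((continuousOn_extChartAt p).mono hKs)
  have hsub : extChartAt I p '' K ⊆ (extChartAt I p).target := by
    rintro _ ⟨q, hq, rfl⟩
    exact (extChartAt I p).map_source (hKs hq)
  have hint : IntegrableOn (fun x => √(coordGram I f p x).det) (extChartAt I p '' K) :=
    ((contDiffOn_sqrt_det_coordGram hf p).continuousOn.mono hsub).integrableOn_compact himage
  have h := restrict_areaMeasure hf.smooth p
  calc areaMeasure I f (interior K)
      = (areaMeasure I f).restrict (extChartAt I p).source (interior K) := by
        rw [Measure.restrict_apply hm, inter_eq_self_of_subset_left hKs']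
    _ = ∫⁻ x in (extChartAt I p).target ∩ (extChartAt I p).symm ⁻¹' interior K,
          ENNReal.ofReal √(coordGram I f p x).det := by rw [h, chartArea_apply f p hm]
    _ ≤ ∫⁻ x in extChartAt I p '' K, ENNReal.ofReal √(coordGram I f p x).det := by
        refine lintegral_mono_set ?_
        rintro x ⟨hx, hxK⟩
        exact ⟨_, interior_subset hxK, (extChartAt I p).right_inv hx⟩
    _ < ⊤ := by
        refine lt_of_le_of_lt (lintegral_mono fun x => ?_) hint.hasFiniteIntegral
        rw [← ofReal_norm]
        exact ENNReal.ofReal_le_ofReal (le_abs_self _)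

/-- The integral of a function that vanishes outside of a chart, in the coordinates of the chart. -/
theorem integral_areaMeasure_eq {f : M → Space} (hf : IsSmoothImmersion I f) {c : M} {h : M → ℝ}
    (hm : AEStronglyMeasurable h (areaMeasure I f)) (h0 : ∀ p ∉ (extChartAt I c).source, h p = 0) :
    ∫ p, h p ∂(areaMeasure I f) = ∫ x in (extChartAt I c).target,
      √(coordGram I f c x).det * h ((extChartAt I c).symm x) := by
  have hr := restrict_areaMeasure hf.smooth c
  have hm' : AEStronglyMeasurable h (chartArea I f c) := hr ▸ hm.restrict
  have htm := measurableSet_extChartAt_target I c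
  rw [← setIntegral_eq_integral_of_forall_compl_eq_zero h0, hr, chartArea,
    integral_map (aemeasurable_extChartAt_symm_withDensity I c _) hm',
    integral_withDensity_eq_integral_toReal_smul₀
      ((contDiffOn_sqrt_det_coordGram hf c).continuousOn.aemeasurable htm).ennreal_ofReal
      (Eventually.of_forall fun x => ENNReal.ofReal_lt_top)]
  refine integral_congr_ae (Eventually.of_forall fun x => ?_)
  simp [ENNReal.toReal_ofReal (Real.sqrt_nonneg _)]

/-- The area measure of `f₁` has density `√(|g_f₁| / |g_f₂|)` with respect to that of `f₂`. -/
theorem areaMeasure_eq_withDensity {f₁ f₂ : M → Space} (h₁ : IsSmoothImmersion I f₁)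
    (h₂ : IsSmoothImmersion I f₂) :
    areaMeasure I f₁ =
      (areaMeasure I f₂).withDensity fun p => ENNReal.ofReal (areaRatio I f₁ f₂ p) := by
  have hR : Measurable fun p => ENNReal.ofReal (areaRatio I f₁ f₂ p) :=
    (continuous_areaRatio h₁ h₂).measurable.ennreal_ofReal
  obtain ⟨t, htc, htu⟩ := TopologicalSpace.countable_cover_nhds
    (fun c : M => extChartAt_source_mem_nhds (I := I) c)
  refine Measure.ext_of_biUnion_eq_univ htc htu fun c _ => ?_
  have hsm := measurableSet_extChartAt_source I c
  rw [restrict_withDensity hsm, restrict_areaMeasure h₁.smooth, restrict_areaMeasure h₂.smooth]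
  ext s hs
  have htm := measurableSet_target_inter_preimage I c hs
  rw [withDensity_apply _ hs, ← lintegral_indicator hs,
    lintegral_chartArea h₂ c (hR.indicator hs), chartArea_apply f₁ c hs,
    ← lintegral_indicator htm, ← lintegral_indicator (measurableSet_extChartAt_target I c)]
  refine lintegral_congr fun x => ?_
  by_cases hx : x ∈ (extChartAt I c).target
  · by_cases hxs : (extChartAt I c).symm x ∈ s
    · rw [indicator_of_mem (mem_inter hx hxs), indicator_of_mem hx, indicator_of_mem hxs,
        areaRatio_eq_coordGram h₁.smooth h₂.smooth ((extChartAt I c).map_target hx),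
        (extChartAt I c).right_inv hx, ← ENNReal.ofReal_mul (Real.sqrt_nonneg _),
        ← Real.sqrt_mul (det_coordGram_pos h₂ hx).le,
        mul_div_cancel₀ _ (det_coordGram_pos h₂ hx).ne']
    · rw [indicator_of_notMem (fun h => hxs h.2), indicator_of_mem hx, indicator_of_notMem hxs,
        mul_zero]
  · rw [indicator_of_notMem (fun h => hx h.1), indicator_of_notMem hx]

theorem integral_areaMeasure_eq_integral_areaRatio_mul {f₁ f₂ : M → Space}
    (h₁ : IsSmoothImmersion I f₁) (h₂ : IsSmoothImmersion I f₂) (h : M → ℝ) :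
    ∫ p, h p ∂(areaMeasure I f₁) = ∫ p, areaRatio I f₁ f₂ p * h p ∂(areaMeasure I f₂) := by
  rw [areaMeasure_eq_withDensity h₁ h₂, integral_withDensity_eq_integral_toReal_smul
    (continuous_areaRatio h₁ h₂).measurable.ennreal_ofReal
    (Eventually.of_forall fun p => ENNReal.ofReal_lt_top)]
  refine integral_congr_ae (Eventually.of_forall fun p => ?_)
  have : 0 ≤ areaRatio I f₁ f₂ p := Real.sqrt_nonneg _
  simp [ENNReal.toReal_ofReal this]

end Area

/-! ### Test functions and the scalar product of gradients -/

section TestFunction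

variable {H : Type*} [TopologicalSpace H] {I : ModelWithCorners ℝ Plane H}
  {M : Type*} [TopologicalSpace M] [ChartedSpace H M]

theorem IsTestFunction.mul {B : M → ℝ} (hB : IsTestFunction I B) {ρ : M → ℝ}
    (hρ : ContMDiff I 𝓘(ℝ, ℝ) ∞ ρ) : IsTestFunction I (fun p => ρ p * B p) where
  smooth := hρ.mul hB.smooth
  hasCompactSupport := hB.hasCompactSupport.mul_left
  eq_zero_of_mem_boundary p hp := by rw [hB.eq_zero_of_mem_boundary p hp, mul_zero]

theorem IsTestFunction.continuous_mul {B : M → ℝ} (hB : IsTestFunction I B) {U : Set M}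
    (hU : IsOpen U) (hBU : tsupport B ⊆ U) {h : M → ℝ} (hh : ContinuousOn h U) :
    Continuous fun p => h p * B p := by
  refine continuous_of_tsupport fun p hp => ?_
  have hpU : p ∈ U := hBU (tsupport_mul_subset_right hp)
  exact (hh.continuousAt (hU.mem_nhds hpU)).mul hB.smooth.continuous.continuousAt

theorem gradInner_eq_zero_of_notMem_tsupport (f : M → Space) (u : M → ℝ) {B : M → ℝ} {p : M}
    (hp : p ∉ tsupport B) : gradInner I f u B p = 0 := by
  have h : B =ᶠ[𝓝 p] fun _ => (0 : ℝ) := notMem_tsupport_iff_eventuallyEq.1 hp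
  have h1 : mfderiv I 𝓘(ℝ, ℝ) B p = 0 := h.mfderiv_eq.trans mfderiv_const
  have h2 : metricGradient I f B p = (0 : Plane) := by
    unfold metricGradient
    rw [h1]
    exact (congrArg (WithLp.toLp 2) (Matrix.mulVec_zero _)).trans (WithLp.toLp_zero 2)
  rw [gradInner, h2]
  exact (congrArg (@inner ℝ Space _ (mfderiv I 𝓘(ℝ, Space) f p (metricGradient I f u p)))
    (map_zero (mfderiv I 𝓘(ℝ, Space) f p))).trans (inner_zero_right (E := Space) _)

theorem contMDiff_sum_mul {ι : Type*} (s : Finset ι) (a : ι → ℝ) {B : ι → M → ℝ}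
    (hB : ∀ j, ContMDiff I 𝓘(ℝ, ℝ) ∞ (B j)) :
    ContMDiff I 𝓘(ℝ, ℝ) ∞ fun p => ∑ j ∈ s, a j * B j p :=
  contMDiff_finsetSum fun j _ => contMDiff_const.mul (hB j)

variable [IsManifold I ∞ M]

theorem gradInner_comm {f : M → Space} (hf : IsSmoothImmersion I f) {u v : M → ℝ}
    (hu : ContMDiff I 𝓘(ℝ, ℝ) ∞ u) (hv : ContMDiff I 𝓘(ℝ, ℝ) ∞ v) (p : M) :
    gradInner I f u v p = gradInner I f v u p := by
  have hp := mem_extChartAt_source (I := I) p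
  rw [gradInner_eq_dualInner hf hu hv hp, gradInner_eq_dualInner hf hv hu hp,
    dualInner_comm (transpose_coordGram f p _)]

theorem gradInner_sum_mul {f : M → Space} (hf : IsSmoothImmersion I f) {ι : Type*} (s : Finset ι)
    (a : ι → ℝ) {B : ι → M → ℝ} (hB : ∀ j, ContMDiff I 𝓘(ℝ, ℝ) ∞ (B j)) {v : M → ℝ}
    (hv : ContMDiff I 𝓘(ℝ, ℝ) ∞ v) (p : M) :
    gradInner I f (fun q => ∑ j ∈ s, a j * B j q) v p = ∑ j ∈ s, a j * gradInner I f (B j) v p := by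
  have hp := mem_extChartAt_source (I := I) p
  have hx := (extChartAt I p).map_source hp
  have hd : ∀ j, DifferentiableWithinAt ℝ (B j ∘ (extChartAt I p).symm) (range I)
      (extChartAt I p p) := fun j =>
    differentiableWithinAt_range (contDiffOn_comp_extChartAt_symm (hB j) p) hx
  have hud := I.uniqueDiffOn _ (extChartAt_target_subset_range p hx)
  have h1 : coordDiff I (fun q => ∑ j ∈ s, a j * B j q) p (extChartAt I p p) =
      ∑ j ∈ s, a j • coordDiff I (B j) p (extChartAt I p p) := by
    ext i
    have h2 : fderivWithin ℝ ((fun q => ∑ j ∈ s, a j * B j q) ∘ (extChartAt I p).symm) (range I)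
        (extChartAt I p p) = ∑ j ∈ s, a j • fderivWithin ℝ (B j ∘ (extChartAt I p).symm) (range I)
          (extChartAt I p p) :=
      (HasFDerivWithinAt.fun_sum fun j _ =>
        (hd j).hasFDerivWithinAt.const_mul (a j)).fderivWithin hud
    simp only [coordDiff, partialDeriv, h2, Finset.sum_apply, Pi.smul_apply,
      _root_.sum_apply, _root_.smul_apply]
  rw [gradInner_eq_dualInner hf (contMDiff_sum_mul s a hB) hv hp, h1, dualInner, sum_dotProduct]
  refine Finset.sum_congr rfl fun j _ => ?_
  rw [gradInner_eq_dualInner hf (hB j) hv hp, smul_dotProduct, dualInner, smul_eq_mul]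

end TestFunction

/-! ### Interior points and the fundamental lemma of the calculus of variations -/

section Interior

variable {H : Type*} [TopologicalSpace H] {I : ModelWithCorners ℝ Plane H}
  {M : Type*} [TopologicalSpace M] [ChartedSpace H M]

/-- Every neighbourhood of `p`, even of a boundary point, contains the image of a nonempty open
subset of the plane in the preferred chart at `p`. -/
theorem exists_isOpen_subset_target (p : M) {O : Set M} (hO : O ∈ 𝓝 p) :
    ∃ W : Set Plane, IsOpen W ∧ W.Nonempty ∧
      W ⊆ (extChartAt I p).target ∩ (extChartAt I p).symm ⁻¹' O := by
  have hx := mem_extChartAt_target (I := I) p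
  have h2 : (extChartAt I p).symm ⁻¹' O ∈ 𝓝 (extChartAt I p p) :=
    extChartAt_preimage_mem_nhds hO
  obtain ⟨O', hO's, hO'o, hO'x⟩ := mem_nhds_iff.1 h2
  obtain ⟨y, hyO, hyi⟩ := mem_closure_iff.1 (extChartAt_target_subset_closure_interior hx) O' hO'o
    hO'x
  exact ⟨O' ∩ interior (extChartAt I p).target, hO'o.inter isOpen_interior, ⟨y, hyO, hyi⟩,
    fun z hz => ⟨interior_subset hz.2, hO's hz.1⟩⟩

variable [IsManifold I ∞ M]

theorem mem_interior_iff_extChartAt {c p : M} (hp : p ∈ (extChartAt I c).source) :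
    p ∈ I.interior M ↔ extChartAt I c p ∈ interior (extChartAt I c).target := by
  rw [extChartAt_source] at hp
  exact I.isInteriorPoint_iff_of_mem_atlas (n := ∞) (by simp) (chart_mem_atlas H c) hp

theorem dense_interior : Dense (I.interior M) := by
  refine fun p => mem_closure_iff_nhds.2 fun O hO => ?_
  obtain ⟨W, hWo, ⟨x, hx⟩, hW⟩ := exists_isOpen_subset_target (I := I) p hO
  have hxt := (hW hx).1
  refine ⟨(extChartAt I p).symm x, (hW hx).2,
    (mem_interior_iff_extChartAt ((extChartAt I p).map_target hxt)).2 ?_⟩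
  rw [(extChartAt I p).right_inv hxt]
  exact interior_maximal (fun y hy => (hW hy).1) hWo hx

/-- A test function vanishes at the points that any given chart sends to the frontier: being a
boundary point does not depend on the chart. -/
theorem IsTestFunction.eq_zero_of_mem_frontier {B : M → ℝ} (hB : IsTestFunction I B) {c : M}
    {x : Plane} (hx : x ∈ (extChartAt I c).target) (hfr : x ∈ frontier (range I)) :
    B ((extChartAt I c).symm x) = 0 := by
  refine hB.eq_zero_of_mem_boundary _ ?_
  rw [← ModelWithCorners.compl_interior, mem_compl_iff,
    mem_interior_iff_extChartAt ((extChartAt I c).map_target hx), (extChartAt I c).right_inv hx]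
  exact fun h => hfr.2 (interior_mono (extChartAt_target_subset_range c) h)

/-- Near an interior point, a bump function with small support is a test function. -/
theorem exists_isTestFunction [T2Space M] {p : M} (hp : p ∈ I.interior M) {O : Set M}
    (hO : O ∈ 𝓝 p) : ∃ B : M → ℝ, IsTestFunction I B ∧ tsupport B ⊆ O ∧ 0 ≤ B ∧ B p = 1 := by
  have hi : I.interior M ∈ 𝓝 p := (I.isOpen_interior (n := ∞) (by simp)).mem_nhds hp
  obtain ⟨β, -, hβ⟩ := (SmoothBumpFunction.nhds_basis_tsupport (I := I) p).mem_iff.1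
    (inter_mem hO hi)
  refine ⟨β, ⟨β.contMDiff, β.hasCompactSupport, fun q hq => ?_⟩, fun q hq => (hβ hq).1,
    fun q => β.nonneg, β.eq_one⟩
  rw [← ModelWithCorners.compl_interior] at hq
  exact image_eq_zero_of_notMem_tsupport fun h => hq (hβ h).2

end Interior

section Area

variable {H : Type*} [TopologicalSpace H] {I : ModelWithCorners ℝ Plane H}
  {M : Type*} [TopologicalSpace M] [ChartedSpace H M] [MeasurableSpace M] [BorelSpace M]
  [IsManifold I ∞ M]

theorem isOpenPosMeasure_areaMeasure {f : M → Space} (hf : IsSmoothImmersion I f) :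
    (areaMeasure I f).IsOpenPosMeasure := by
  refine ⟨fun O hO ⟨p, hp⟩ h0 => ?_⟩
  obtain ⟨W, hWo, hWne, hW⟩ := exists_isOpen_subset_target (I := I) p (hO.mem_nhds hp)
  have hm := measurableSet_target_inter_preimage I p hO.measurableSet
  have h1 : chartArea I f p O = 0 :=
    le_antisymm (h0 ▸ (le_iSup (chartArea I f) p : chartArea I f p ≤ areaMeasure I f) O) bot_le
  have hae : AEMeasurable (fun x => ENNReal.ofReal √(coordGram I f p x).det)
      (volume.restrict ((extChartAt I p).target ∩ (extChartAt I p).symm ⁻¹' O)) :=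
    ((((contDiffOn_sqrt_det_coordGram hf p).continuousOn.mono inter_subset_left).aemeasurable
      hm)).ennreal_ofReal
  rw [chartArea_apply f p hO.measurableSet, lintegral_eq_zero_iff' hae,
    EventuallyEq, ae_restrict_iff' hm] at h1
  have h2 : volume W = 0 := by
    refine measure_mono_null (fun x hx => ?_) (ae_iff.1 h1)
    simp only [Pi.zero_apply, ENNReal.ofReal_eq_zero, not_le, mem_ofPred_eq, Classical.not_imp]
    exact ⟨hW hx, Real.sqrt_pos.2 (det_coordGram_pos hf (hW hx).1)⟩
  exact (hWo.measure_pos volume hWne).ne' h2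

variable [SecondCountableTopology M]

theorem IsTestFunction.integrable_mul {f : M → Space} (hf : IsSmoothImmersion I f) {B : M → ℝ}
    (hB : IsTestFunction I B) {U : Set M} (hU : IsOpen U) (hBU : tsupport B ⊆ U) {h : M → ℝ}
    (hh : ContinuousOn h U) : Integrable (fun p => h p * B p) (areaMeasure I f) := by
  have := isLocallyFiniteMeasure_areaMeasure hf
  exact (hB.continuous_mul hU hBU hh).integrable_of_hasCompactSupport hB.hasCompactSupport.mul_left

/-- A continuous function on an open set `U` that is orthogonal to all the test functions supported
in `U` is zero, at the boundary points of `U` too, as the interior points are dense. -/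
theorem eq_zero_of_integral_mul_eq_zero [T2Space M] {f : M → Space} (hf : IsSmoothImmersion I f)
    {U : Set M} (hU : IsOpen U) {h : M → ℝ} (hh : ContinuousOn h U)
    (h0 : ∀ B : M → ℝ, IsTestFunction I B → tsupport B ⊆ U →
      ∫ p, h p * B p ∂(areaMeasure I f) = 0) {p : M} (hp : p ∈ U) : h p = 0 := by
  have := isLocallyFiniteMeasure_areaMeasure hf
  have := isOpenPosMeasure_areaMeasure hf
  have hint : ∀ q ∈ U, q ∈ I.interior M → h q = 0 := by
    intro q hq hqi
    by_contra hne
    -- multiplication by the constant `h q` makes the integrand nonnegative for either sign of `h q`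
    have hpos : ∀ᶠ r in 𝓝 q, 0 < h q * h r :=
      (continuousAt_const.mul (hh.continuousAt (hU.mem_nhds hq))).eventually_const_lt
        (mul_self_pos.2 hne)
    obtain ⟨B, hB, hBs, hB0, hB1⟩ := exists_isTestFunction hqi
      (inter_mem (hU.mem_nhds hq) hpos)
    have hBU : tsupport B ⊆ U := fun r hr => (hBs hr).1
    have hlt := (continuous_const.mul (hB.continuous_mul hU hBU hh) :
      Continuous fun r => h q * (h r * B r)).integral_pos_of_hasCompactSupport_nonneg_nonzero
        (μ := areaMeasure I f) (x := q) hB.hasCompactSupport.mul_left.mul_left ?_ ?_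
    · refine hlt.ne' ((integral_const_mul (h q) fun r => h r * B r).trans ?_)
      rw [h0 B hB hBU, mul_zero]
    · intro r
      by_cases hr : r ∈ tsupport B
      · have := mul_nonneg (hBs hr).2.le (hB0 r)
        simpa [mul_assoc] using this
      · simp [image_eq_zero_of_notMem_tsupport hr]
    · simp [hB1, hne]
  -- a nonzero value at `p` persists near `p`, hence at some interior point
  by_contra hne
  have hev : {q | h q ≠ 0} ∩ U ∈ 𝓝 p := inter_mem
    ((hh.continuousAt (hU.mem_nhds hp)).eventually_ne hne) (hU.mem_nhds hp)
  obtain ⟨q, ⟨hq0, hqU⟩, hqi⟩ := mem_closure_iff_nhds.1 (dense_interior (I := I) p) _ hev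
  exact hq0 (hint q hqU hqi)

/-! ### Green's formula -/

/-- Green's formula for test functions supported in the domain of a chart. -/
theorem integral_coordLaplacian_mul [T2Space M] {f : M → Space} (hf : IsSmoothImmersion I f)
    {u : M → ℝ} (hu : ContMDiff I 𝓘(ℝ, ℝ) ∞ u) {c : M} {B : M → ℝ} (hB : IsTestFunction I B)
    (hBc : tsupport B ⊆ (extChartAt I c).source) :
    ∫ p, coordLaplacian I f u c (extChartAt I c p) * B p ∂(areaMeasure I f) =
      -∫ p, gradInner I f u B p ∂(areaMeasure I f) := by
  have hcL : ContinuousOn (fun p => coordLaplacian I f u c (extChartAt I c p))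
      (extChartAt I c).source :=
    continuousOn_of_eq_comp_extChartAt (continuousOn_coordLaplacian hf c hu) fun _ _ => rfl
  rw [integral_areaMeasure_eq hf (c := c)
      (hB.continuous_mul (isOpen_extChartAt_source c) hBc hcL).aestronglyMeasurable
      (fun p hp => by rw [image_eq_zero_of_notMem_tsupport fun h => hp (hBc h), mul_zero]),
    integral_areaMeasure_eq hf (c := c) (continuous_gradInner hf hu hB.smooth).aestronglyMeasurable
      (fun p hp => gradInner_eq_zero_of_notMem_tsupport f u fun h => hp (hBc h))]
  set t := (extChartAt I c).target with ht
  have htm : MeasurableSet t := measurableSet_extChartAt_target I c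
  set b := B ∘ (extChartAt I c).symm with hb
  have hparts := fun i => integral_partialDeriv_mul_eq_neg (contDiffOn_coordFlux hf c hu i)
    (contDiffOn_comp_extChartAt_symm hB.smooth c)
    (K := extChartAt I c '' tsupport B)
    (hB.hasCompactSupport.image_of_continuousOn ((continuousOn_extChartAt c).mono hBc))
    (by rintro _ ⟨p, hp, rfl⟩; exact (extChartAt I c).map_source (hBc hp))
    (fun x hx hxK => image_eq_zero_of_notMem_tsupport (f := B) fun h =>
      hxK ⟨_, h, (extChartAt I c).right_inv hx⟩)
    (fun x hx hfr => hB.eq_zero_of_mem_frontier hx hfr) i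
  calc ∫ x in t, √(coordGram I f c x).det * (coordLaplacian I f u c
        (extChartAt I c ((extChartAt I c).symm x)) * B ((extChartAt I c).symm x))
      = ∫ x in t, ∑ i, partialDeriv I (coordFlux I f u c i) i x * b x := by
        refine setIntegral_congr_fun htm fun x hx => ?_
        rw [(extChartAt I c).right_inv hx, ← mul_assoc, sqrt_det_mul_coordLaplacian hf c u hx,
          Finset.sum_mul]
        rfl
    _ = ∑ i, ∫ x in t, partialDeriv I (coordFlux I f u c i) i x * b x :=
        integral_finsetSum _ fun i _ => (hparts i).1
    _ = -∑ i, ∫ x in t, coordFlux I f u c i x * partialDeriv I b i x := by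
        rw [← Finset.sum_neg_distrib]
        exact Finset.sum_congr rfl fun i _ => (hparts i).2.2
    _ = -∫ x in t, ∑ i, coordFlux I f u c i x * partialDeriv I b i x := by
        rw [integral_finsetSum _ fun i _ => (hparts i).2.1]
    _ = _ := by
        congr 1
        refine setIntegral_congr_fun htm fun x hx => ?_
        rw [gradInner_eq_dualInner hf hu hB.smooth ((extChartAt I c).map_target hx),
          (extChartAt I c).right_inv hx, hb, sum_coordFlux_mul_partialDeriv,
          dualInner_comm (transpose_coordGram f c x)]

/-- The coordinate expression of the Laplace–Beltrami operator does not depend on the chart: by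
Green's formula, the expressions in two charts have the same integrals against test functions. -/
theorem coordLaplacian_eq_coordLaplacian [T2Space M] {f : M → Space} (hf : IsSmoothImmersion I f)
    {u : M → ℝ} (hu : ContMDiff I 𝓘(ℝ, ℝ) ∞ u) {c d p : M} (hc : p ∈ (extChartAt I c).source)
    (hd : p ∈ (extChartAt I d).source) :
    coordLaplacian I f u c (extChartAt I c p) = coordLaplacian I f u d (extChartAt I d p) := by
  have hcont : ∀ e : M, ContinuousOn (fun p => coordLaplacian I f u e (extChartAt I e p))
      (extChartAt I e).source := fun e =>
    continuousOn_of_eq_comp_extChartAt (continuousOn_coordLaplacian hf e hu) fun _ _ => rfl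
  refine sub_eq_zero.1 <| eq_zero_of_integral_mul_eq_zero hf
    (U := (extChartAt I c).source ∩ (extChartAt I d).source)
    (h := fun p => coordLaplacian I f u c (extChartAt I c p) -
      coordLaplacian I f u d (extChartAt I d p))
    ((isOpen_extChartAt_source c).inter (isOpen_extChartAt_source d))
    (((hcont c).mono inter_subset_left).sub ((hcont d).mono inter_subset_right))
    (fun B hB hBU => ?_) ⟨hc, hd⟩
  have hBc := hBU.trans inter_subset_left
  have hBd := hBU.trans inter_subset_right
  simp only [sub_mul]
  rw [integral_sub (hB.integrable_mul hf (isOpen_extChartAt_source c) hBc (hcont c))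
    (hB.integrable_mul hf (isOpen_extChartAt_source d) hBd (hcont d)),
    integral_coordLaplacian_mul hf hu hB hBc, integral_coordLaplacian_mul hf hu hB hBd, sub_self]

theorem continuous_laplaceBeltrami [T2Space M] {f : M → Space} (hf : IsSmoothImmersion I f)
    {u : M → ℝ} (hu : ContMDiff I 𝓘(ℝ, ℝ) ∞ u) : Continuous (laplaceBeltrami I f u) :=
  continuous_of_continuousOn_source fun c =>
    continuousOn_of_eq_comp_extChartAt (continuousOn_coordLaplacian hf c hu) fun p hp =>
      coordLaplacian_eq_coordLaplacian hf hu (mem_extChartAt_source p) hp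

theorem IsTestFunction.integrable_gradInner {f : M → Space} (hf : IsSmoothImmersion I f)
    {u B : M → ℝ} (hu : ContMDiff I 𝓘(ℝ, ℝ) ∞ u) (hB : IsTestFunction I B) :
    Integrable (gradInner I f u B) (areaMeasure I f) := by
  have := isLocallyFiniteMeasure_areaMeasure hf
  refine (continuous_gradInner hf hu hB.smooth).integrable_of_hasCompactSupport ?_
  exact hB.hasCompactSupport.mono' fun p hp => by_contra fun h =>
    hp (gradInner_eq_zero_of_notMem_tsupport f u h)

/-- Green's formula: the boundary term vanishes because the test function does. -/
theorem integral_laplaceBeltrami_mul [T2Space M] {f : M → Space} (hf : IsSmoothImmersion I f)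
    {u : M → ℝ} (hu : ContMDiff I 𝓘(ℝ, ℝ) ∞ u) {B : M → ℝ} (hB : IsTestFunction I B) :
    ∫ p, laplaceBeltrami I f u p * B p ∂(areaMeasure I f) =
      -∫ p, gradInner I f u B p ∂(areaMeasure I f) := by
  have := Manifold.locallyCompact_of_finiteDimensional (M := M) I
  obtain ⟨ρ, hρ⟩ := SmoothPartitionOfUnity.exists_isSubordinate_chartAt_source I M
  have hfin := ρ.locallyFinite.finite_nonempty_inter_compact hB.hasCompactSupport
  set s := hfin.toFinset with hs
  have hsum : ∀ p, B p = ∑ i ∈ s, 1 * (ρ i p * B p) := by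
    intro p
    simp only [one_mul, ← Finset.sum_mul]
    by_cases hp : p ∈ tsupport B
    · rw [ρ.sum_finsupport' p (mem_univ p), one_mul]
      intro i hi
      rw [hs, Finite.mem_toFinset]
      exact ⟨p, (ρ.mem_finsupport p).1 hi, hp⟩
    · rw [image_eq_zero_of_notMem_tsupport hp, mul_zero]
  have hρB : ∀ i, IsTestFunction I fun p => ρ i p * B p := fun i => hB.mul (ρ i).contMDiff
  have hsupp : ∀ i, tsupport (fun p => ρ i p * B p) ⊆ (extChartAt I i).source := fun i => by
    rw [extChartAt_source]
    exact tsupport_mul_subset_left.trans (hρ i)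
  have hLc := continuous_laplaceBeltrami hf hu
  calc ∫ p, laplaceBeltrami I f u p * B p ∂(areaMeasure I f)
      = ∫ p, ∑ i ∈ s, laplaceBeltrami I f u p * (ρ i p * B p) ∂(areaMeasure I f) := by
        refine integral_congr_ae (Eventually.of_forall fun p => ?_)
        beta_reduce
        conv_lhs => rw [hsum p, Finset.mul_sum]
        simp only [one_mul]
    _ = ∑ i ∈ s, ∫ p, laplaceBeltrami I f u p * (ρ i p * B p) ∂(areaMeasure I f) :=
        integral_finsetSum _ fun i _ =>
          (hρB i).integrable_mul hf isOpen_univ (subset_univ _) hLc.continuousOn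
    _ = ∑ i ∈ s, -∫ p, gradInner I f u (fun q => ρ i q * B q) p ∂(areaMeasure I f) := by
        refine Finset.sum_congr rfl fun i _ => ?_
        rw [← integral_coordLaplacian_mul hf hu (hρB i) (hsupp i)]
        refine integral_congr_ae (Eventually.of_forall fun p => ?_)
        by_cases hp : p ∈ (extChartAt I i).source
        · exact congrArg (· * (ρ i p * B p))
            (coordLaplacian_eq_coordLaplacian hf hu (mem_extChartAt_source p) hp)
        · have h0 : ρ i p * B p = 0 := image_eq_zero_of_notMem_tsupport
            (f := fun p => ρ i p * B p) fun h => hp (hsupp i h)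
          simp only [h0, mul_zero]
    _ = -∫ p, ∑ i ∈ s, gradInner I f u (fun q => ρ i q * B q) p ∂(areaMeasure I f) := by
        rw [integral_finsetSum _ fun i _ => (hρB i).integrable_gradInner hf hu,
          Finset.sum_neg_distrib]
    _ = _ := by
        congr 1
        refine integral_congr_ae (Eventually.of_forall fun p => ?_)
        beta_reduce
        conv_rhs => rw [funext hsum]
        rw [gradInner_comm hf hu (contMDiff_sum_mul s _ fun i => (hρB i).smooth),
          gradInner_sum_mul hf s _ (fun i => (hρB i).smooth) hu]
        exact Finset.sum_congr rfl fun i _ => by rw [one_mul, gradInner_comm hf hu (hρB i).smooth]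

end Area

/-! ### The velocity of a family of immersions -/

section Velocity

variable {H : Type*} [TopologicalSpace H] {I : ModelWithCorners ℝ Plane H}
  {M : Type*} [TopologicalSpace M] [ChartedSpace H M] {J : Set ℝ} {Φ : ℝ → M → Space}

theorem IsImmersionFamily.uniqueDiffOn (hΦ : IsImmersionFamily I J Φ) : UniqueDiffOn ℝ J := by
  obtain ⟨a, ha, b, hb, hab⟩ := hΦ.nontrivial.exists_lt
  refine uniqueDiffOn_convex hΦ.ordConnected.convex ?_
  have hsub : Ioo a b ⊆ interior J :=
    interior_maximal (Ioo_subset_Icc_self.trans (hΦ.ordConnected.out ha hb)) isOpen_Ioo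
  exact (nonempty_Ioo.2 hab).mono hsub

/-- The velocity is continuous in space, at the endpoints of `J` too. -/
theorem continuous_velocity [IsManifold I ∞ M] (hΦ : IsImmersionFamily I J Φ) {t : ℝ}
    (ht : t ∈ J) : Continuous (velocity J Φ t) := by
  refine continuous_of_continuousOn_source (I := I) fun c => ?_
  set T := (extChartAt I c).target with hT
  -- the family in the chart, jointly smooth up to the ends of `J` and up to the boundary
  set G : ℝ × Plane → Space := fun z => Φ z.1 ((extChartAt I c).symm z.2) with hG
  have hGs : ContDiffOn ℝ ∞ G (J ×ˢ T) := by
    have h1 : ContMDiffOn 𝓘(ℝ, ℝ × Plane) (𝓘(ℝ, ℝ).prod I) ∞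
        (fun z : ℝ × Plane => (z.1, (extChartAt I c).symm z.2)) (J ×ˢ T) :=
      (contDiff_fst.contMDiff.contMDiffOn).prodMk
        ((contMDiffOn_extChartAt_symm c).comp contDiff_snd.contMDiff.contMDiffOn fun z hz => hz.2)
    exact contMDiffOn_iff_contDiffOn.1 (hΦ.smooth.comp h1 fun z hz => ⟨hz.1, mem_univ _⟩)
  have hud : UniqueDiffOn ℝ (J ×ˢ T) := hΦ.uniqueDiffOn.prod (uniqueDiffOn_extChartAt_target c)
  have hcont : ContinuousOn (fun x => fderivWithin ℝ G (J ×ˢ T) (t, x) (1, 0)) T :=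
    (((hGs.continuousOn_fderivWithin hud (by simp)).comp (by fun_prop)
      fun x hx => ⟨ht, hx⟩).clm_apply continuousOn_const)
  refine continuousOn_of_eq_comp_extChartAt hcont fun p hp => ?_
  have hx := (extChartAt I c).map_source hp
  have h1 : HasFDerivWithinAt G (fderivWithin ℝ G (J ×ˢ T) (t, extChartAt I c p)) (J ×ˢ T)
      (t, extChartAt I c p) :=
    ((hGs.differentiableOn (by simp)) _ ⟨ht, hx⟩).hasFDerivWithinAt
  have h2 : HasDerivWithinAt (fun s : ℝ => (s, extChartAt I c p)) ((1 : ℝ), (0 : Plane)) J t :=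
    (hasDerivWithinAt_id t J).prodMk (hasDerivWithinAt_const t J _)
  have h3 := (h1.comp_hasDerivWithinAt t h2 fun s hs => mk_mem_prod hs hx).derivWithin
    (hΦ.uniqueDiffOn t ht)
  rw [← h3, velocity]
  congr 1
  ext1 s
  rw [Function.comp_apply, hG]
  simp only [(extChartAt I c).left_inv hp]

end Velocity

/-! ### Linear combinations -/

section LinComb

variable {M : Type*} {N : ℕ}

theorem linComb_apply (y : Fin N → Space) (B : Fin N → M → ℝ) (p : M) (a : Fin 3) :
    linComb y B p a = ∑ j, y j a * B j p := by
  simp [linComb, mul_comm]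

theorem velocity_eq_linComb {J : Set ℝ} {Φ : ℝ → M → Space} {t : ℝ} (ht : t ∈ J)
    (hJ : UniqueDiffWithinAt ℝ J t) {B : Fin N → M → ℝ} {x : ℝ → Fin N → Space}
    (hx : ∀ s ∈ J, Φ s = linComb (x s) B)
    (hd : ∀ j, DifferentiableWithinAt ℝ (fun s => x s j) J t) :
    velocity J Φ t = linComb (fun j => derivWithin (fun s => x s j) J t) B := by
  ext1 p
  have h : HasDerivWithinAt (fun s => linComb (x s) B p)
      (linComb (fun j => derivWithin (fun s => x s j) J t) B p) J t :=
    HasDerivWithinAt.fun_sum fun j _ => (hd j).hasDerivWithinAt.const_smul (B j p)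
  rw [← h.derivWithin hJ]
  exact derivWithin_congr (fun s hs => by rw [hx s hs]) (by rw [hx t ht])

theorem sum_smul_eq_sum_smul_iff (a b : Fin N → ℝ) (y z : Fin N → Space) :
    ∑ j, a j • y j = ∑ j, b j • z j ↔ ∀ k, ∑ j, a j * y j k = ∑ j, b j * z j k := by
  rw [PiLp.ext_iff]
  simp

end LinComb

/-! ### Weak forms -/

section Weak

variable {H : Type*} [TopologicalSpace H] {I : ModelWithCorners ℝ Plane H}
  {M : Type*} [TopologicalSpace M] [ChartedSpace H M]

theorem contMDiff_component {Ψ : M → Space} (hΨ : ContMDiff I 𝓘(ℝ, Space) ∞ Ψ) (a : Fin 3) :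
    ContMDiff I 𝓘(ℝ, ℝ) ∞ fun p => Ψ p a :=
  (EuclideanSpace.proj a : Space →L[ℝ] ℝ).contDiff.contMDiff.comp hΨ

theorem contMDiff_linComb {N : ℕ} (y : Fin N → Space) {B : Fin N → M → ℝ}
    (hB : ∀ j, ContMDiff I 𝓘(ℝ, ℝ) ∞ (B j)) : ContMDiff I 𝓘(ℝ, Space) ∞ (linComb y B) :=
  contMDiff_finsetSum fun j _ => (hB j).smul contMDiff_const

theorem pdeAt_iff {J : Set ℝ} {Φ : ℝ → M → Space} {t : ℝ} {p : M} :
    PDEAt I J Φ t p ↔ ∀ a, velocity J Φ t p a -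
      areaRatio I (Φ 0) (Φ t) p * vectorLaplacian I (Φ 0) (Φ t) p a = 0 := by
  rw [PDEAt, PiLp.ext_iff]
  exact forall_congr' fun a => sub_eq_zero.symm

variable [IsManifold I ∞ M] [SecondCountableTopology M] [MeasurableSpace M]
  [BorelSpace M] {f g : M → Space} (hf : IsSmoothImmersion I f) (hg : IsSmoothImmersion I g)

include hf in
theorem continuous_vectorLaplacian_apply [T2Space M] {Ψ : M → Space}
    (hΨ : ContMDiff I 𝓘(ℝ, Space) ∞ Ψ) (a : Fin 3) :
    Continuous fun p => vectorLaplacian I f Ψ p a :=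
  continuous_laplaceBeltrami hf (contMDiff_component hΨ a)

include hf in
theorem integral_vectorLaplacian_mul [T2Space M] {Ψ : M → Space}
    (hΨ : ContMDiff I 𝓘(ℝ, Space) ∞ Ψ) {B : M → ℝ} (hB : IsTestFunction I B) (a : Fin 3) :
    ∫ p, vectorLaplacian I f Ψ p a * B p ∂(areaMeasure I f) =
      stiffnessForm I f (fun p => Ψ p a) B :=
  integral_laplaceBeltrami_mul hf (contMDiff_component hΨ a) hB

include hf hg in
/-- The factor `√(|g_f| / |g_g|)` turns the area measure of `g` into that of `f`. -/
theorem integral_areaRatio_mul_mul_eq (w B : M → ℝ) :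
    ∫ p, (areaRatio I f g p * w p) * B p ∂(areaMeasure I g) =
      ∫ p, w p * B p ∂(areaMeasure I f) := by
  rw [integral_areaMeasure_eq_integral_areaRatio_mul hg hf]
  refine integral_congr_ae (Eventually.of_forall fun p => ?_)
  beta_reduce
  rw [← mul_assoc, ← mul_assoc, areaRatio_mul_areaRatio hg hf, one_mul]

/-- For each test function, the Galerkin equation of the PDE is the equation of the modified flow:
the factor in the PDE turns the area measure of time `t` into that of time `0`, and Green's formula
for the metric of time `0` applies. -/
theorem galerkinPDEAt_iff_modifiedFlowAt [T2Space M] {J : Set ℝ} {Φ : ℝ → M → Space}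
    (hΦ : IsImmersionFamily I J Φ) {t : ℝ} (ht : t ∈ J) {B : M → ℝ} (hB : IsTestFunction I B) :
    GalerkinPDEAt I J Φ t B ↔ ModifiedFlowAt I J Φ t B := by
  refine forall_congr' fun a => ?_
  rw [integral_areaRatio_mul_mul_eq hΦ.initial (hΦ.immersion t ht),
    integral_vectorLaplacian_mul hΦ.initial (hΦ.immersion t ht).smooth hB]
  rfl

/-- The modified flow is the weak form of the PDE. -/
theorem tfae_pdeAt [T2Space M] {J : Set ℝ} {Φ : ℝ → M → Space} (hΦ : IsImmersionFamily I J Φ)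
    {t : ℝ} (ht : t ∈ J) : List.TFAE [
      ∀ p : M, PDEAt I J Φ t p,
      ∀ p ∈ I.interior M, PDEAt I J Φ t p,
      ∀ B : M → ℝ, IsTestFunction I B → GalerkinPDEAt I J Φ t B,
      ∀ B : M → ℝ, IsTestFunction I B → ModifiedFlowAt I J Φ t B] := by
  have h0 := hΦ.initial
  have h1 := hΦ.immersion t ht
  have hv : ∀ a, Continuous fun p => velocity J Φ t p a := fun a =>
    (EuclideanSpace.proj a : Space →L[ℝ] ℝ).continuous.comp (continuous_velocity hΦ ht)
  have hw : ∀ a, Continuous fun p => areaRatio I (Φ 0) (Φ t) p *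
      vectorLaplacian I (Φ 0) (Φ t) p a := fun a =>
    (continuous_areaRatio h0 h1).mul (continuous_vectorLaplacian_apply h0 h1.smooth a)
  tfae_have 1 → 2 := fun h p _ => h p
  tfae_have 2 → 1 := by
    intro h p
    refine pdeAt_iff.2 fun a => ?_
    have hext := ((hv a).sub (hw a)).ext_on (dense_interior (I := I)) continuous_const
      (g := fun _ => (0 : ℝ)) fun q hq => pdeAt_iff.1 (h q hq) a
    exact congrFun hext p
  tfae_have 1 → 3 := by
    intro h B _ a
    refine integral_congr_ae (Eventually.of_forall fun p => ?_)
    beta_reduce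
    rw [sub_eq_zero.1 (pdeAt_iff.1 (h p) a)]
  tfae_have 3 → 1 := by
    intro h p
    refine pdeAt_iff.2 fun a => ?_
    refine eq_zero_of_integral_mul_eq_zero h1 isOpen_univ (h := fun p => velocity J Φ t p a -
      areaRatio I (Φ 0) (Φ t) p * vectorLaplacian I (Φ 0) (Φ t) p a)
      ((hv a).sub (hw a)).continuousOn (fun B hB hBU => ?_) (mem_univ p)
    simp only [sub_mul]
    rw [integral_sub (hB.integrable_mul h1 isOpen_univ hBU (hv a).continuousOn)
      (hB.integrable_mul h1 isOpen_univ hBU (hw a).continuousOn), sub_eq_zero]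
    exact h B hB a
  tfae_have 3 ↔ 4 := forall₂_congr fun B hB => galerkinPDEAt_iff_modifiedFlowAt hΦ ht hB
  tfae_finish

/-! ### Finite elements -/

variable {N : ℕ} {B : Fin N → M → ℝ} (hBs : ∀ j, ContMDiff I 𝓘(ℝ, ℝ) ∞ (B j)) {i : Fin N}
  (hBi : IsTestFunction I (B i))
include hf hBs hBi

/-- The mass form with a basis function is a row of the mass matrix. -/
theorem massForm_linComb (y : Fin N → Space) (a : Fin 3) :
    massForm I f (fun p => linComb y B p a) (B i) = ∑ j, massMatrix I f B i j * y j a := by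
  simp only [massForm, linComb_apply, Finset.sum_mul, mul_assoc]
  rw [integral_finsetSum _ fun j _ => (hBi.integrable_mul hf isOpen_univ (subset_univ _)
    (hBs j).continuous.continuousOn).const_mul (y j a)]
  refine Finset.sum_congr rfl fun j _ => ?_
  rw [integral_const_mul, mul_comm]
  simp only [massMatrix, Matrix.of_apply, massForm, mul_comm]

/-- The stiffness form with a basis function is a row of the stiffness matrix. -/
theorem stiffnessForm_linComb (y : Fin N → Space) (a : Fin 3) :
    stiffnessForm I f (fun p => linComb y B p a) (B i) =
      ∑ j, stiffnessMatrix I f B i j * y j a := by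
  simp only [stiffnessForm, linComb_apply]
  rw [funext (gradInner_sum_mul hf Finset.univ (fun j => y j a) hBs hBi.smooth),
    integral_finsetSum _ fun j _ => (hBi.integrable_gradInner hf (hBs j)).const_mul (y j a),
    ← Finset.sum_neg_distrib]
  refine Finset.sum_congr rfl fun j _ => ?_
  rw [integral_const_mul, stiffnessMatrix, Matrix.of_apply, stiffnessForm,
    funext (gradInner_comm hf hBi.smooth (hBs j))]
  ring

end Weak

end ModifiedMCF

end

theorem mainTheorem2
    {H : Type*} [TopologicalSpace H] (I : ModelWithCorners ℝ Plane H)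
    {M : Type*} [TopologicalSpace M] [ChartedSpace H M] [IsManifold I ∞ M]
    [T2Space M] [SecondCountableTopology M] [MeasurableSpace M] [BorelSpace M]
    (J : Set ℝ) (Φ : ℝ → M → Space) (hΦ : IsImmersionFamily I J Φ)
    (t : ℝ) (ht : t ∈ J) :
    -- change of variables and divergence theorem, for every test function
    (∀ B : M → ℝ, IsTestFunction I B → ∀ a : Fin 3,
      Integrable (fun p => velocity J Φ t p a * B p)
        (areaMeasure I (Φ t)) ∧
      Integrable (fun p => (areaRatio I (Φ t) (Φ 0) p *
        velocity J Φ t p a) * B p) (areaMeasure I (Φ 0)) ∧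
      Integrable (fun p => (areaRatio I (Φ 0) (Φ t) p *
        vectorLaplacian I (Φ 0) (Φ t) p a) * B p)
        (areaMeasure I (Φ t)) ∧
      Integrable (fun p => vectorLaplacian I (Φ 0) (Φ t) p a * B p)
        (areaMeasure I (Φ 0)) ∧
      Integrable (gradInner I (Φ 0) (fun p => Φ t p a) B)
        (areaMeasure I (Φ 0)) ∧
      ∫ p, velocity J Φ t p a * B p ∂(areaMeasure I (Φ t)) =
        ∫ p, (areaRatio I (Φ t) (Φ 0) p * velocity J Φ t p a) * B p
          ∂(areaMeasure I (Φ 0)) ∧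
      ∫ p, (areaRatio I (Φ 0) (Φ t) p *
          vectorLaplacian I (Φ 0) (Φ t) p a) * B p
          ∂(areaMeasure I (Φ t)) =
        ∫ p, vectorLaplacian I (Φ 0) (Φ t) p a * B p
          ∂(areaMeasure I (Φ 0)) ∧
      ∫ p, vectorLaplacian I (Φ 0) (Φ t) p a * B p
          ∂(areaMeasure I (Φ 0)) =
        -∫ p, gradInner I (Φ 0) (fun q => Φ t q a) B p
          ∂(areaMeasure I (Φ 0))) ∧
    -- the modified flow is the weak form of the PDE
    List.TFAE [
      ∀ p : M, PDEAt I J Φ t p,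
      ∀ p ∈ I.interior M, PDEAt I J Φ t p,
      ∀ B : M → ℝ, IsTestFunction I B → GalerkinPDEAt I J Φ t B,
      ∀ B : M → ℝ, IsTestFunction I B → ModifiedFlowAt I J Φ t B] ∧
    -- finite elements: the Galerkin equations are the system with the mass matrix of time `t` and
    -- the stiffness matrix of time `0`
    (∀ (N : ℕ) (B : Fin N → M → ℝ) (x : ℝ → Fin N → Space),
      (∀ i, ContMDiff I 𝓘(ℝ, ℝ) ∞ (B i)) →
      (∀ s ∈ J, Φ s = linComb (x s) B) →
      ∀ i, IsTestFunction I (B i) →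
      ((∀ j, DifferentiableWithinAt ℝ (fun s => x s j) J t) →
        (GalerkinPDEAt I J Φ t (B i) ↔
          ∑ j, massMatrix I (Φ t) B i j • derivWithin (fun s => x s j) J t =
            ∑ j, stiffnessMatrix I (Φ 0) B i j • x t j)) ∧
      -- the semi-implicit time step of size `δ`, with new coefficients `y`
      (∀ (δ : ℝ), 0 < δ → ∀ y : Fin N → Space,
        ((∀ a : Fin 3,
            ∫ p, (δ⁻¹ * (linComb y B p a - Φ t p a)) * B i p
              ∂(areaMeasure I (Φ t)) =
            ∫ p, (areaRatio I (Φ 0) (Φ t) p *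
              vectorLaplacian I (Φ 0) (linComb y B) p a) * B i p
              ∂(areaMeasure I (Φ t))) ↔
          ∑ j, (massMatrix I (Φ t) B - δ • stiffnessMatrix I (Φ 0) B) i j
              • y j =
            ∑ j, massMatrix I (Φ t) B i j • x t j))) := by
  have h0 := hΦ.initial
  have h1 := hΦ.immersion t ht
  refine ⟨fun B hB a => ?_, tfae_pdeAt hΦ ht, ?_⟩
  · have hv : Continuous fun p => velocity J Φ t p a :=
      (EuclideanSpace.proj a : Space →L[ℝ] ℝ).continuous.comp (continuous_velocity hΦ ht)
    have hL := continuous_vectorLaplacian_apply h0 h1.smooth a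
    have hint : ∀ {f : M → Space}, IsSmoothImmersion I f → ∀ {w : M → ℝ}, Continuous w →
        Integrable (fun p => w p * B p) (areaMeasure I f) := fun hf _ hw =>
      hB.integrable_mul hf isOpen_univ (Set.subset_univ _) hw.continuousOn
    refine ⟨hint h1 hv, hint h0 ((continuous_areaRatio h1 h0).mul hv),
      hint h1 ((continuous_areaRatio h0 h1).mul hL), hint h0 hL,
      hB.integrable_gradInner h0 (contMDiff_component h1.smooth a),
      (integral_areaRatio_mul_mul_eq h1 h0 _ B).symm, integral_areaRatio_mul_mul_eq h0 h1 _ B,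
      integral_vectorLaplacian_mul h0 h1.smooth hB a⟩
  · intro N B x hBs hx i hBi
    refine ⟨fun hd => ?_, fun δ hδ y => ?_⟩
    · rw [galerkinPDEAt_iff_modifiedFlowAt hΦ ht hBi, sum_smul_eq_sum_smul_iff]
      refine forall_congr' fun a => ?_
      rw [velocity_eq_linComb ht (hΦ.uniqueDiffOn t ht) hx hd,
        massForm_linComb h1 hBs hBi, ← stiffnessForm_linComb h0 hBs hBi, ← hx t ht]
    · rw [sum_smul_eq_sum_smul_iff]
      refine forall_congr' fun a => ?_
      have hy := contMDiff_linComb (I := I) y hBs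
      have hint : ∀ {Ψ : M → Space}, ContMDiff I 𝓘(ℝ, Space) ∞ Ψ →
          Integrable (fun p => Ψ p a * B i p) (areaMeasure I (Φ t)) := fun hΨ =>
        hBi.integrable_mul h1 isOpen_univ (Set.subset_univ _)
          (contMDiff_component hΨ a).continuous.continuousOn
      have hL : ∫ p, (areaRatio I (Φ 0) (Φ t) p * vectorLaplacian I (Φ 0) (linComb y B) p a) *
          B i p ∂(areaMeasure I (Φ t)) = ∑ j, stiffnessMatrix I (Φ 0) B i j * y j a := by
        rw [integral_areaRatio_mul_mul_eq h0 h1, integral_vectorLaplacian_mul h0 hy hBi,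
          stiffnessForm_linComb h0 hBs hBi]
      have hD : ∫ p, (δ⁻¹ * (linComb y B p a - Φ t p a)) * B i p ∂(areaMeasure I (Φ t)) =
          δ⁻¹ * (∑ j, massMatrix I (Φ t) B i j * y j a -
            ∑ j, massMatrix I (Φ t) B i j * x t j a) := by
        rw [← massForm_linComb h1 hBs hBi, ← massForm_linComb h1 hBs hBi, massForm, massForm,
          ← hx t ht, ← integral_sub (hint hy) (hint h1.smooth), ← integral_const_mul]
        refine integral_congr_ae (Filter.Eventually.of_forall fun p => ?_)
        beta_reduce
        ring
      rw [hL, hD, inv_mul_eq_iff_eq_mul₀ hδ.ne']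
      simp only [Matrix.sub_apply, Matrix.smul_apply, smul_eq_mul, sub_mul, Finset.sum_sub_distrib,
        mul_assoc, ← Finset.mul_sum]
      constructor <;> intro h <;> linarith
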